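/- **Setting.** Let $a,b>0$, $a\neq b$, $ab=1$, $U_0=\operatorname{diag}(a,b)$, $U_1=\operatorname{diag}(b,a)$, $K=SO(2)U_0\cup SO(2)U_1$, and $\bar c=\operatorname{dist}(SO(2)U_0,SO(2)U_1)$; matrix distances are taken in the Euclidean (Frobenius) norm. Let $Q\in SO(2)$ be the rotation with $U_0-QU_1=\frac{a^2-b^2}{a^2+b^2}\binom{a}{-b}\otimes\binom{1}{1}$, let $\lambda\in(0,1)$ and $F_\lambda=\lambda U_0+(1-\lambda)QU_1$. Let $\Omega=\operatorname{conv}\{(-5,1),(3,1),(5,-1),(-3,-1)\}\subset\mathbb R^2$. For $n\ge 1$ let $n\Omega=\{(i,j)\in\mathbb Z^2:(i/n,j/n)\in\Omega\}$, and consider the grid triangles $\Delta^{n,+}_{i,j}=\operatorname{conv}\{(\frac in,\frac jn),(\frac in,\frac{j+1}n),(\frac{i+1}n,\frac jn)\}$ and $\Delta^{n,-}_{i,j}=\operatorname{conv}\{(\frac in,\frac jn),(\frac{i-1}n,\frac jn),(\frac in,\frac{j-1}n)\}$. **Admissible deformations.** $\mathcal A_n^{F_\lambda}$ consists of the continuous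 $H^1$ deformations $u$ of $\Omega$ into $\mathbb R^2$, with lattice values $u^{i,j}=u(i/n,j/n)$, such that the orientation of every grid triangle contained in $\Omega$ is preserved, that is, $\det(u^{i+1,j}-u^{i,j},u^{i,j+1}-u^{i,j})>0$ if $\Delta^{n,+}_{i,j}\subset\Omega$ and $\det(u^{i-1,j}-u^{i,j},u^{i,j-1}-u^{i,j})>0$ if $\Delta^{n,-}_{i,j}\subset\Omega$, and such that, for some $c\in\mathbb R^2$, $u^{i,j}=F_\lambda(i/n,j/n)$ for $i+j\le-4n$ and $u^{i,j}=F_\lambda(i/n,j/n)+c$ for $i+j\ge 4n$ (also at lattice points outside $\Omega$). Such a $u$ is called piecewise affine on the grid if it is affine on every grid triangle contained in $\Omega$. **Hamiltonian.** For $G=(v,v',w,w')\in(\mathbb R^2)^4$ put $$\bar h_{a,b}(G)=(|v|^2-a^2)^2+(|v'|^2-a^2)^2+(|w|^2-b^2)^2+(|w'|^2-b^2)^2+|v\cdot w|+|v\cdot w'|+|v'\cdot w|+|v'\cdot w'|,$$ $$h(G)=\gamma(|G|)\,\bar h_{a,b}(G)\,\bar h_{b,a}(G)+(1-\gamma(|G|))\,k(G),$$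 where $\gamma\in C^\infty(\mathbb R,[0,1])$ satisfies $\gamma(t)=1$ for $|t|\le10(\bar c+1)$ and $\gamma(t)=0$ for $|t|\ge20(\bar c+1)$, and $k$ is locally Lipschitz with $c_1|G|^2\le k(G)\le c_2|G|^2$ for some constants $c_1,c_2>0$. With $U^{i,j}=n\,(u^{i+1,j}-u^{i,j},\,u^{i,j}-u^{i-1,j},\,u^{i,j+1}-u^{i,j},\,u^{i,j}-u^{i,j-1})$ let $$H_n(u)=\sum_{(i,j)\in n\Omega,\ |j|<n} n^{-2}\,\hat h(U^{i,j}),$$ where $\hat h$ is either $h$ itself or, more generally, any function on $(\mathbb R^2)^4$ for which there is a constant $c_0>0$ such that $\hat h(U^{i,j})\ge c_0\,h(U^{i,j})$ for all $n\ge1$, all piecewise affine $u\in\mathcal A_n^{F_\lambda}$ and all $(i,j)$ in the sum. (The rows $j=\pm n$ are left out because $u$ has no values at the vertical neighbours of their points; adding nonnegative terms for them would only strengthen the energy bound below.) **Lemma 2.1.** Let $u_n\in\mathcal A_n^{F_\lambda}$, $n\ge1$, be piecewise affine on the grid, with $H_n(u_n)\le C/n$ for all $n\ge 1$ and a constant $C$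 independent of $n$. Then there are a subsequence $(n_j)$ and disjoint Caccioppoli sets (measurable sets of finite perimeter) $\Omega_0,\Omega_1$ with $\Omega_0\cup\Omega_1=\Omega$ such that $$\operatorname{dist}(\nabla u_{n_j},SO(2)U_0)\to0\ \text{ in }L^2(\Omega_0),\qquad \operatorname{dist}(\nabla u_{n_j},SO(2)U_1)\to0\ \text{ in }L^2(\Omega_1)\qquad(j\to\infty).$$ -/

import Mathlib

open Filter Topology MeasureTheory
open scoped ContDiff

namespace TwoWell

noncomputable section

/-! ### The plane, the grid and the reference domain -/

/-- The plane with its Euclidean norm. -/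
abbrev Plane : Type := EuclideanSpace ℝ (Fin 2)

/-- The lattice point `(i/n, j/n)`. -/
def pt (n : ℕ) (i j : ℤ) : Plane := !₂[(i : ℝ) / n, (j : ℝ) / n]

/-- The (closed) parallelogram with vertices `(-d-l,l)`, `(d-l,l)`, `(d+l,-l)`, `(l-d,-l)`. -/
def parallelogram (d l : ℝ) : Set Plane :=
  convexHull ℝ {!₂[-d - l, l], !₂[d - l, l], !₂[d + l, -l], !₂[l - d, -l]}

/-- The reference domain `Ω`; explicitly `|x₂| ≤ 1` and `|x₁ + x₂| ≤ 4`. -/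
def Omega : Set Plane := parallelogram 4 1

/-- The index set `nΩ` of the grid points in `Ω`. -/
def gridIndex (n : ℕ) : Set (ℤ × ℤ) := {p | pt n p.1 p.2 ∈ Omega}

/-- The grid triangle with right angle at `(i/n, j/n)` opening to the upper right. -/
def triPlus (n : ℕ) (i j : ℤ) : Set Plane :=
  convexHull ℝ {pt n i j, pt n i (j + 1), pt n (i + 1) j}

/-- The grid triangle with right angle at `(i/n, j/n)` opening to the lower left. -/
def triMinus (n : ℕ) (i j : ℤ) : Set Plane :=
  convexHull ℝ {pt n i j, pt n (i - 1) j, pt n i (j - 1)}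

/-! ### The wells -/

/-- `diag(a, b)`; the two wells are generated by `U₀ = diag(a, b)` and `U₁ = diag(b, a)`. -/
def U (a b : ℝ) : Matrix (Fin 2) (Fin 2) ℝ := !![a, 0; 0, b]

/-- The energy well `SO(2) M`. -/
def well (M : Matrix (Fin 2) (Fin 2) ℝ) : Set (Matrix (Fin 2) (Fin 2) ℝ) :=
  {A | ∃ R ∈ Matrix.specialOrthogonalGroup (Fin 2) ℝ, A = R * M}

/-- The rotation `Q` for which `U₀ - Q U₁` has rank one with normal `(1, 1)`. -/
def Q (a b : ℝ) : Matrix (Fin 2) (Fin 2) ℝ :=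
  (1 / (a ^ 2 + b ^ 2)) • !![2 * a * b, -(a ^ 2 - b ^ 2); a ^ 2 - b ^ 2, 2 * a * b]

theorem Q_mem_specialOrthogonalGroup {a b : ℝ} (ha : 0 < a) (hb : 0 < b) :
    Q a b ∈ Matrix.specialOrthogonalGroup (Fin 2) ℝ := by
  have h : a ^ 2 + b ^ 2 ≠ 0 := by positivity
  rw [Matrix.mem_specialOrthogonalGroup_iff, Matrix.mem_orthogonalGroup_iff]
  constructor
  · ext i j
    fin_cases i <;> fin_cases j <;>
      simp [Q, Matrix.mul_apply, Fin.sum_univ_two] <;> field_simp <;> ring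
  · simp [Q, Matrix.det_fin_two]
    field_simp
    ring

theorem U_sub_Q_mul_U {a b : ℝ} (ha : 0 < a) (hb : 0 < b) :
    U a b - Q a b * U b a =
      ((a ^ 2 - b ^ 2) / (a ^ 2 + b ^ 2)) • Matrix.vecMulVec ![a, -b] ![1, 1] := by
  have h : a ^ 2 + b ^ 2 ≠ 0 := by positivity
  ext i j
  fin_cases i <;> fin_cases j <;>
    simp [Q, U, Matrix.mul_apply, Fin.sum_univ_two, Matrix.vecMulVec_apply] <;>
    field_simp <;> first | ring1 | (ring_nf; simp)

/-- The boundary matrix `F_λ = λ U₀ + (1 - λ) Q U₁`. -/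
def F (a b lam : ℝ) : Matrix (Fin 2) (Fin 2) ℝ :=
  lam • U a b + (1 - lam) • (Q a b * U b a)

/-- The linear map `x ↦ M x` of the plane. -/
def act (M : Matrix (Fin 2) (Fin 2) ℝ) (x : Plane) : Plane :=
  WithLp.toLp 2 (M.mulVec x.ofLp)

section Frobenius

open scoped Matrix.Norms.Frobenius

/-- `dist(A, SO(2) M)`, in the Frobenius (Euclidean) norm of matrices. -/
def distWell (A M : Matrix (Fin 2) (Fin 2) ℝ) : ℝ := Metric.infDist A (well M)

/-- The distance `dist(SO(2) U₀, SO(2) U₁)` of the two wells, in the Frobenius norm. -/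
def wellDist (a b : ℝ) : ℝ :=
  sInf {r | ∃ A ∈ well (U a b), ∃ B ∈ well (U b a), r = dist A B}

end Frobenius

/-! ### Admissible deformations -/

/-- The orientation `det (v, w)`. -/
def det2 (v w : Plane) : ℝ := v 0 * w 1 - v 1 * w 0

/-- Admissible deformations: continuity on `Ω`, non-interpenetration (the orientation of every
grid triangle contained in `Ω` is preserved) and the boundary conditions at the lattice points
with `i + j ≤ -4n` and `i + j ≥ 4n`. Deformations are functions on the whole plane; apart from
their values in `Ω` only the prescribed lattice values next to `Ω` are ever used. -/
structure IsAdmissible (a b lam : ℝ) (n : ℕ) (u : Plane → Plane) : Prop where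
  continuousOn : ContinuousOn u Omega
  orient_plus : ∀ i j : ℤ, triPlus n i j ⊆ Omega →
    0 < det2 (u (pt n (i + 1) j) - u (pt n i j)) (u (pt n i (j + 1)) - u (pt n i j))
  orient_minus : ∀ i j : ℤ, triMinus n i j ⊆ Omega →
    0 < det2 (u (pt n (i - 1) j) - u (pt n i j)) (u (pt n i (j - 1)) - u (pt n i j))
  left_bc : ∀ i j : ℤ, i + j ≤ -4 * (n : ℤ) → u (pt n i j) = act (F a b lam) (pt n i j)
  right_bc : ∃ c : Plane, ∀ i j : ℤ, 4 * (n : ℤ) ≤ i + j →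
    u (pt n i j) = act (F a b lam) (pt n i j) + c

/-- `u` is affine on each grid triangle contained in `Ω` (so that `u ∈ H¹(Ω)`, these triangles
being finitely many and covering `Ω`). -/
def IsPiecewiseAffine (n : ℕ) (u : Plane → Plane) : Prop :=
  (∀ i j : ℤ, triPlus n i j ⊆ Omega → ∃ A : Plane →ᵃ[ℝ] Plane, Set.EqOn u A (triPlus n i j)) ∧
  (∀ i j : ℤ, triMinus n i j ⊆ Omega → ∃ A : Plane →ᵃ[ℝ] Plane, Set.EqOn u A (triMinus n i j))

/-- The matrix `∇u(x)`, with entries `∂ⱼ uᵢ(x)`. For piecewise affine `u` it exists off the edges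
of the triangles, a null set. -/
def grad (u : Plane → Plane) (x : Plane) : Matrix (Fin 2) (Fin 2) ℝ :=
  Matrix.of fun i j => (fderiv ℝ u x (EuclideanSpace.single j 1)) i

/-! ### The Hamiltonian -/

/-- Quadruples of vectors, `(ℝ²)⁴`, with the Euclidean norm. -/
abbrev Quad : Type := PiLp 2 (fun _ : Fin 4 => Plane)

/-- The difference quotients `(∂₁u^{i,j}, ∂₁u^{i-1,j}, ∂₂u^{i,j}, ∂₂u^{i,j-1})`. -/
def stencil (n : ℕ) (u : Plane → Plane) (p : ℤ × ℤ) : Quad :=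
  WithLp.toLp 2 ![
    (n : ℝ) • (u (pt n (p.1 + 1) p.2) - u (pt n p.1 p.2)),
    (n : ℝ) • (u (pt n p.1 p.2) - u (pt n (p.1 - 1) p.2)),
    (n : ℝ) • (u (pt n p.1 (p.2 + 1)) - u (pt n p.1 p.2)),
    (n : ℝ) • (u (pt n p.1 p.2) - u (pt n p.1 (p.2 - 1)))]

/-- The bracket measuring the deviation of lengths and angles from the well of `diag(a, b)`. The
angle term is the sum of the absolute values over the four choices of signs. -/
def bracket (a b : ℝ) (G : Quad) : ℝ :=
  (‖G 0‖ ^ 2 - a ^ 2) ^ 2 + (‖G 1‖ ^ 2 - a ^ 2) ^ 2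
    + (‖G 2‖ ^ 2 - b ^ 2) ^ 2 + (‖G 3‖ ^ 2 - b ^ 2) ^ 2
    + (|inner ℝ (G 0) (G 2)| + |inner ℝ (G 0) (G 3)|
      + |inner ℝ (G 1) (G 2)| + |inner ℝ (G 1) (G 3)|)

/-- The local density before truncation. -/
def modelDensity (a b : ℝ) (G : Quad) : ℝ := bracket a b G * bracket b a G

/-- Smooth cut-off functions with values in `[0, 1]`, adapted to the distance `cbar` of the
wells. -/
structure IsCutoff (cbar : ℝ) (g : ℝ → ℝ) : Prop where
  smooth : ContDiff ℝ ∞ g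
  mem_Icc : ∀ t, g t ∈ Set.Icc (0 : ℝ) 1
  eq_one : ∀ t, |t| ≤ 10 * (cbar + 1) → g t = 1
  eq_zero : ∀ t, 20 * (cbar + 1) ≤ |t| → g t = 0

/-- (Locally) Lipschitz functions of exactly quadratic growth. -/
structure HasQuadraticGrowth (k : Quad → ℝ) : Prop where
  locallyLipschitz : LocallyLipschitz k
  bounds : ∃ c₁ c₂ : ℝ, 0 < c₁ ∧ 0 < c₂ ∧ ∀ G, c₁ * ‖G‖ ^ 2 ≤ k G ∧ k G ≤ c₂ * ‖G‖ ^ 2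

/-- The truncated local density `h = γ(|G|) h̃(G) + (1 - γ(|G|)) k(G)`. -/
def density (a b : ℝ) (g : ℝ → ℝ) (k : Quad → ℝ) (G : Quad) : ℝ :=
  g ‖G‖ * modelDensity a b G + (1 - g ‖G‖) * k G

/-- The points of `nΩ` at which the local energy is defined. Its left and right neighbours carry
values everywhere in `nΩ` (beyond the lateral sides these are the prescribed boundary values), but
above the top row `j = n` and below the bottom row `j = -n` the deformation has no values. As
densities are nonnegative, any convention for these two rows only increases the energy. -/
def bulkIndex (n : ℕ) : Set (ℤ × ℤ) := {p | p ∈ gridIndex n ∧ |p.2| < (n : ℤ)}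

/-- The set of points over which the energy is summed is finite. -/
theorem bulkIndex_finite {n : ℕ} (hn : 1 ≤ n) : (bulkIndex n).Finite := by
  have hsub : Omega ⊆ {x : Plane | -5 ≤ x 0 ∧ x 0 ≤ 5} := by
    apply convexHull_min
    · rintro x (rfl | rfl | rfl | rfl) <;> norm_num
    · intro x hx y hy s t hs ht hst
      simp only [Set.mem_ofPred_eq, PiLp.add_apply, PiLp.smul_apply, smul_eq_mul] at *
      constructor <;> nlinarith
  apply ((Set.finite_Icc (-5 * (n : ℤ)) (5 * n)).prod (Set.finite_Icc (-(n : ℤ)) n)).subset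
  rintro ⟨i, j⟩ ⟨h1, h2⟩
  have hpos : (0 : ℝ) < n := by exact_mod_cast hn
  obtain ⟨h3, h4⟩ := hsub h1
  simp only [pt, PiLp.toLp_apply, Matrix.cons_val_zero] at h3 h4
  rw [le_div_iff₀ hpos] at h3
  rw [div_le_iff₀ hpos] at h4
  have h2' := abs_lt.mp h2
  simp only [Set.mem_prod, Set.mem_Icc]
  refine ⟨⟨by exact_mod_cast h3, by exact_mod_cast h4⟩, h2'.1.le, h2'.2.le⟩

/-- The Hamiltonian `H_n(u) = ∑ n⁻² h(∂₁u^{i,j}, ∂₁u^{i-1,j}, ∂₂u^{i,j}, ∂₂u^{i,j-1})` with local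
density `h`. -/
def energy (h : Quad → ℝ) (n : ℕ) (u : Plane → Plane) : ℝ :=
  ∑ᶠ p ∈ bulkIndex n, ((n : ℝ) ^ 2)⁻¹ * h (stencil n u p)

/-- The class of Hamiltonians: the density `hhat` is bounded from below by a positive multiple of
the density `h` on all admissible deformations. -/
def DominatesDensity (a b lam : ℝ) (h hhat : Quad → ℝ) : Prop :=
  ∃ c₁ : ℝ, 0 < c₁ ∧ ∀ n : ℕ, 1 ≤ n → ∀ u : Plane → Plane,
    IsAdmissible a b lam n u → IsPiecewiseAffine n u →
      ∀ p ∈ bulkIndex n, c₁ * h (stencil n u p) ≤ hhat (stencil n u p)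

/-! ### Caccioppoli sets and convergence -/

/-- The divergence of a vector field. -/
def divergence (X : Plane → Plane) (x : Plane) : ℝ :=
  ∑ i : Fin 2, (fderiv ℝ X x (EuclideanSpace.single i 1)) i

/-- The perimeter of `E` in the plane (De Giorgi): the supremum of `∫_E div X` over all compactly
supported `C¹` vector fields with `|X| ≤ 1`. -/
def perimeter (E : Set Plane) : ENNReal :=
  ⨆ (X : Plane → Plane) (_ : ContDiff ℝ 1 X) (_ : HasCompactSupport X) (_ : ∀ x, ‖X x‖ ≤ 1),
    ENNReal.ofReal (∫ x in E, divergence X x)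

/-- Caccioppoli sets: measurable sets of finite perimeter. -/
def IsCaccioppoli (E : Set Plane) : Prop := MeasurableSet E ∧ perimeter E < ⊤

/-- `f_j → 0` in `L²(S)`. -/
def TendstoZeroL2 (f : ℕ → Plane → ℝ) (S : Set Plane) : Prop :=
  (∀ j, MemLp (f j) 2 (volume.restrict S)) ∧
    Tendsto (fun j => eLpNorm (f j) 2 (volume.restrict S)) atTop (𝓝 0)

end

end TwoWell

namespace TwoWell

noncomputable section

open scoped symmDiff ENNReal

/-! Before truncation the density is a product of two nonnegative brackets, one for each well. Both
compare the same bond lengths, one with `a` and `b`, the other with `b` and `a`, so their sum stays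
above a fixed gap. Assign each grid point to the phase of its smaller bracket. The larger bracket is
then bounded below, so the density controls the smaller one; since orientation is preserved, it also
controls the squared distance of the gradient from the well of that phase
(`exists_distWell_sq_le_density`). For large stencils the quadratic growth takes over. The energy
bound `C/n` says that the unweighted sum of the densities is `O(n)`.

Neighbouring grid points share a bond. If they belong to different phases, that bond would have to
be close to both lengths, so one of the two points has density at least some `δ > 0`
(`exists_le_density_of_jump`). Hence there are only `O(n)` interfaces, each of length `1/n`, and the
union of the grid squares of one phase has bounded perimeter.

Perimeter is handled through the bound `|E ∆ (E - t)| ≤ C (|t₀| + |t₁|)`. It is elementary for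
unions of squares (`hasTranslationBound_gridSet`), passes to limits in measure, yields compactness
by a direct Kolmogorov–Riesz argument (`exists_subseq_tendsto_measure`) and implies finite perimeter
by difference quotients (`isCaccioppoli_of_hasTranslationBound`). The limit set cut with `Ω` and its
complement in `Ω` are the two Caccioppoli sets.

For the convergence, the squared distance is at most a constant times the energy at the corners of
the square, except on a boundary strip and where the discrete phase differs from the limit; there
only the bound with `1 + energy` holds (`exists_distWell_grad_sq_le`). The energy terms integrate to
`O(1/n)` and the measure of the exceptional set tends to zero. -/

/-! ### The distance from the wells -/

/-- The matrix with columns `v` and `w`. -/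
def columns (v w : Plane) : Matrix (Fin 2) (Fin 2) ℝ := !![v 0, w 0; v 1, w 1]

section Frobenius

open scoped Matrix.Norms.Frobenius

theorem frobenius_norm_sq (A : Matrix (Fin 2) (Fin 2) ℝ) :
    ‖A‖ ^ 2 = A 0 0 ^ 2 + A 0 1 ^ 2 + A 1 0 ^ 2 + A 1 1 ^ 2 := by
  rw [Matrix.frobenius_norm_def, ← Real.rpow_natCast, ← Real.rpow_mul (by positivity)]
  simp [Fin.sum_univ_two]
  ring

theorem continuous_distWell (M : Matrix (Fin 2) (Fin 2) ℝ) :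
    Continuous fun A : Matrix (Fin 2) (Fin 2) ℝ => distWell A M :=
  Metric.continuous_infDist_pt _

theorem rotation_mem_specialOrthogonalGroup {c s : ℝ} (h : c ^ 2 + s ^ 2 = 1) :
    !![c, -s; s, c] ∈ Matrix.specialOrthogonalGroup (Fin 2) ℝ := by
  rw [Matrix.mem_specialOrthogonalGroup_iff, Matrix.mem_orthogonalGroup_iff]
  constructor
  · ext i j
    fin_cases i <;> fin_cases j <;> simp [Matrix.mul_apply, Fin.sum_univ_two] <;> linarith
  · simp [Matrix.det_fin_two]
    linarith

/-- One rotation serves as competitor: only upper bounds for the distance are needed, so the nearest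
rotation is never computed. -/
theorem distWell_sq_le_of_rotation (A : Matrix (Fin 2) (Fin 2) ℝ) (a b : ℝ) {c s : ℝ}
    (h : c ^ 2 + s ^ 2 = 1) :
    distWell A (U a b) ^ 2 ≤ (A 0 0 - c * a) ^ 2 + (A 0 1 + s * b) ^ 2
      + (A 1 0 - s * a) ^ 2 + (A 1 1 - c * b) ^ 2 := by
  have h1 : distWell A (U a b) ≤ dist A (!![c, -s; s, c] * U a b) :=
    Metric.infDist_le_dist_of_mem ⟨_, rotation_mem_specialOrthogonalGroup h, rfl⟩
  have h2 : 0 ≤ distWell A (U a b) := Metric.infDist_nonneg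
  refine (pow_le_pow_left₀ h2 h1 2).trans (le_of_eq ?_)
  rw [dist_eq_norm, frobenius_norm_sq]
  simp [U, Matrix.mul_apply, Fin.sum_univ_two]

theorem distWell_nonneg (A M : Matrix (Fin 2) (Fin 2) ℝ) : 0 ≤ distWell A M :=
  Metric.infDist_nonneg

/-- This is all that is used about the distance of the wells: it makes the threshold `10 (cbar + 1)`
at least 1, so that `‖G‖ ≥ 1` wherever the cut-off differs from 1. -/
theorem wellDist_nonneg (a b : ℝ) : 0 ≤ wellDist a b := by
  apply Real.sInf_nonneg
  rintro r ⟨A, -, B, -, rfl⟩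
  exact dist_nonneg

end Frobenius

theorem norm_sq_eq (v : Plane) : ‖v‖ ^ 2 = v 0 ^ 2 + v 1 ^ 2 := by
  rw [EuclideanSpace.norm_sq_eq]
  simp [Fin.sum_univ_two]

theorem inner_eq (v w : Plane) : inner ℝ v w = v 0 * w 0 + v 1 * w 1 := by
  simp [PiLp.inner_apply, Fin.sum_univ_two]
  ring

/-- The competitor is the identity rotation. This crude growth bound serves for large stencils and
on the exceptional sets. -/
theorem distWell_columns_sq_le (a b : ℝ) (v w : Plane) :
    distWell (columns v w) (U a b) ^ 2 ≤ 2 * (‖v‖ ^ 2 + ‖w‖ ^ 2) + 2 * (a ^ 2 + b ^ 2) := by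
  refine (distWell_sq_le_of_rotation _ a b (c := 1) (s := 0) (by norm_num)).trans ?_
  rw [norm_sq_eq, norm_sq_eq]
  simp only [columns, Matrix.of_apply, Matrix.cons_val', Matrix.cons_val_zero,
    Matrix.cons_val_one, Matrix.cons_val_fin_one]
  nlinarith [sq_nonneg (v 0 + a), sq_nonneg (w 1 + b), sq_nonneg (w 0), sq_nonneg (v 1)]

theorem sq_sub_le_of_pos {x a : ℝ} (ha : 0 < a) (hx : 0 ≤ x) :
    (x - a) ^ 2 ≤ (1 / a ^ 2) * (x ^ 2 - a ^ 2) ^ 2 := by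
  rw [one_div, ← div_eq_inv_mul, le_div_iff₀ (by positivity)]
  have : x ^ 2 - a ^ 2 = (x - a) * (x + a) := by ring
  rw [this, mul_pow]
  apply mul_le_mul_of_nonneg_left _ (sq_nonneg _)
  nlinarith

/-- Orientation-preserving matrices with almost the right column lengths and angle are close to
the well. -/
theorem exists_distWell_columns_sq_le {a b : ℝ} (ha : 0 < a) (hb : 0 < b) :
    ∃ K : ℝ, 0 ≤ K ∧ ∀ v w : Plane, 0 < det2 v w →
      distWell (columns v w) (U a b) ^ 2 ≤
        K * ((‖v‖ ^ 2 - a ^ 2) ^ 2 + (‖w‖ ^ 2 - b ^ 2) ^ 2 + |inner ℝ v w|) := by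
  -- The terms `1/a²` and one `1/b²` pay for the column lengths; `4b/a` pays for the angle when `V ≥
  -- a/2`; `16b²/(3a⁴)` and the second `1/b²` pay for the case `V < a/2`.
  refine ⟨1 / a ^ 2 + 16 * b ^ 2 / (3 * a ^ 4) + 2 / b ^ 2 + 4 * b / a, by positivity, ?_⟩
  intro v w hdet
  have hv : v ≠ 0 := by
    rintro rfl
    simp [det2] at hdet
  have hV : 0 < ‖v‖ := norm_pos_iff.mpr hv
  have hW : 0 ≤ ‖w‖ := norm_nonneg w
  have hv2 := norm_sq_eq v
  have hw2 := norm_sq_eq w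
  have hin := inner_eq v w
  set V := ‖v‖
  set W := ‖w‖
  set p := inner ℝ v w
  -- The competitor is the rotation with first column `v/V`, and `s` is the component of `w` along
  -- its second column. The excess `W - s` measures the failure of orthogonality.
  set s := det2 v w / V with hs
  have hspos : 0 < s := div_pos hdet hV
  have hsV : s * V = v 0 * w 1 - v 1 * w 0 := by rw [hs, det2]; field_simp
  have h1 : distWell (columns v w) (U a b) ^ 2 ≤ (V - a) ^ 2 + (W - b) ^ 2 + 2 * b * (W - s) := by
    have hunit : (v 0 / V) ^ 2 + (v 1 / V) ^ 2 = 1 := by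
      field_simp; linarith
    refine (distWell_sq_le_of_rotation _ a b hunit).trans (le_of_eq ?_)
    simp only [columns, Matrix.of_apply, Matrix.cons_val', Matrix.cons_val_zero,
      Matrix.cons_val_one, Matrix.cons_val_fin_one]
    have e1 : s = (v 0 * w 1 - v 1 * w 0) / V := by rw [hs, det2]
    have e2 : v 0 * (v 0 / V) + v 1 * (v 1 / V) = V := by field_simp; linarith
    calc (v 0 - v 0 / V * a) ^ 2 + (w 0 + v 1 / V * b) ^ 2 + (v 1 - v 1 / V * a) ^ 2
          + (w 1 - v 0 / V * b) ^ 2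
        = (v 0 ^ 2 + v 1 ^ 2) - 2 * a * (v 0 * (v 0 / V) + v 1 * (v 1 / V))
          + (a ^ 2 + b ^ 2) * ((v 0 / V) ^ 2 + (v 1 / V) ^ 2) + (w 0 ^ 2 + w 1 ^ 2)
          - 2 * b * ((v 0 * w 1 - v 1 * w 0) / V) := by ring
      _ = _ := by rw [e2, hunit, ← e1, ← hv2, ← hw2]; ring
  have h2 := sq_sub_le_of_pos ha hV.le
  have h3 := sq_sub_le_of_pos hb hW
  set X := (V ^ 2 - a ^ 2) ^ 2
  set Y := (W ^ 2 - b ^ 2) ^ 2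
  have hX : 0 ≤ X := sq_nonneg _
  have hY : 0 ≤ Y := sq_nonneg _
  have hp : 0 ≤ |p| := abs_nonneg p
  have hk1 : 0 ≤ 1 / a ^ 2 := by positivity
  have hk2 : 0 ≤ 16 * b ^ 2 / (3 * a ^ 4) := by positivity
  have hk3 : 0 ≤ 1 / b ^ 2 := by positivity
  have hk4 : 0 ≤ 4 * b / a := by positivity
  have hk3' : 2 / b ^ 2 = 2 * (1 / b ^ 2) := by ring
  rw [hk3']
  suffices h : 2 * b * (W - s) ≤
      16 * b ^ 2 / (3 * a ^ 4) * X + 1 / b ^ 2 * Y + 4 * b / a * |p| by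
    set k1 := 1 / a ^ 2
    set k2 := 16 * b ^ 2 / (3 * a ^ 4)
    set k3 := 1 / b ^ 2
    set k4 := 4 * b / a
    have e : (k1 + k2 + 2 * k3 + k4) * (X + Y + |p|) =
        (k1 * X + k3 * Y + (k2 * X + k3 * Y + k4 * |p|)) +
        (k1 * Y + k1 * |p| + k2 * Y + k2 * |p| + 2 * (k3 * X) + 2 * (k3 * |p|)
          + k4 * X + k4 * Y) := by ring
    rw [e]
    have : 0 ≤ k1 * Y + k1 * |p| + k2 * Y + k2 * |p| + 2 * (k3 * X) + 2 * (k3 * |p|)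
          + k4 * X + k4 * Y := by positivity
    linarith
  rcases le_or_gt (a / 2) V with hVa | hVa
  -- Lagrange's identity. With `s > 0`, which is where the orientation enters, it gives `V (W - s) ≤
  -- |p|`.
  · have hlag : (s * V) ^ 2 + p ^ 2 = (V * W) ^ 2 := by
      rw [hsV, hin, mul_pow, hv2, hw2]; ring
    have h4 : V * W ≤ s * V + |p| := by
      refine (abs_le_of_sq_le_sq' ?_ (by positivity)).2
      rw [← hlag, ← sq_abs p]
      have : 0 ≤ s * V * |p| := by positivity
      linarith [add_sq (s * V) |p|]
    have h5 : W - s ≤ |p| / V := by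
      rw [le_div_iff₀ hV, sub_mul]; linarith [mul_comm V W]
    have h6 : |p| / V ≤ |p| / (a / 2) := div_le_div_of_nonneg_left hp (by positivity) hVa
    have h7 : 2 * b * (|p| / (a / 2)) = 4 * b / a * |p| := by field_simp; ring
    have h8 : 2 * b * (W - s) ≤ 2 * b * (|p| / (a / 2)) :=
      mul_le_mul_of_nonneg_left (h5.trans h6) (by positivity)
    have := mul_nonneg hk2 hX
    have := mul_nonneg hk3 hY
    linarith
  -- For a short first column the length term is at least `9a⁴/16`, which absorbs the constant
  -- `3b²`.
  · have h4 : 2 * b * (W - s) ≤ 3 * b ^ 2 + (W - b) ^ 2 := by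
      have h5 := sq_nonneg (W - 2 * b)
      have h6 : 0 ≤ b * s := by positivity
      ring_nf at h5 h6 ⊢
      linarith
    have h5 : 9 / 16 * a ^ 4 ≤ X := by
      have : 3 / 4 * a ^ 2 ≤ a ^ 2 - V ^ 2 := by
        have := pow_le_pow_left₀ hV.le hVa.le 2
        rw [div_pow] at this
        linarith
      have h6 := pow_le_pow_left₀ (by positivity) this 2
      have : X = (a ^ 2 - V ^ 2) ^ 2 := by simp only [X]; ring
      rw [this]
      exact le_trans (le_of_eq (by ring)) h6
    have h6 : 3 * b ^ 2 ≤ 16 * b ^ 2 / (3 * a ^ 4) * X := by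
      calc 3 * b ^ 2 = 16 * b ^ 2 / (3 * a ^ 4) * (9 / 16 * a ^ 4) := by field_simp; ring
        _ ≤ _ := mul_le_mul_of_nonneg_left h5 hk2
    have := mul_nonneg hk4 hp
    linarith

/-! ### Lower bounds for the density -/

theorem bracket_nonneg (a b : ℝ) (G : Quad) : 0 ≤ bracket a b G := by
  unfold bracket; positivity

theorem density_comm (a b : ℝ) (g : ℝ → ℝ) (k : Quad → ℝ) :
    density a b g k = density b a g k := by
  funext G
  simp only [density, modelDensity, mul_comm]

theorem quad_norm_sq (G : Quad) :
    ‖G‖ ^ 2 = ‖G 0‖ ^ 2 + ‖G 1‖ ^ 2 + ‖G 2‖ ^ 2 + ‖G 3‖ ^ 2 := by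
  rw [PiLp.norm_sq_eq_of_L2]
  simp [Fin.sum_univ_four]

/-- Half of the gap between the squared bond lengths, squared: if both brackets are below this
value, the stencil would have to be close to both wells. -/
def gap (a b : ℝ) : ℝ := (a ^ 2 - b ^ 2) ^ 2 / 2

theorem gap_pos {a b : ℝ} (ha : 0 < a) (hb : 0 < b) (hne : a ≠ b) : 0 < gap a b := by
  have : a ^ 2 - b ^ 2 ≠ 0 := by
    intro h
    exact hne ((sq_eq_sq₀ ha.le hb.le).mp (by linarith))
  unfold gap; positivity

/-- The sum is least at the midpoint `x = (a² + b²)/2`, where equality holds. -/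
theorem gap_le_add_sq (a b x : ℝ) : gap a b ≤ (x - a ^ 2) ^ 2 + (x - b ^ 2) ^ 2 := by
  unfold gap
  nlinarith [sq_nonneg (2 * x - a ^ 2 - b ^ 2)]

theorem sq_le_bracket_zero (a b : ℝ) (G : Quad) : (‖G 0‖ ^ 2 - a ^ 2) ^ 2 ≤ bracket a b G := by
  unfold bracket
  have : 0 ≤ (‖G 1‖ ^ 2 - a ^ 2) ^ 2 + (‖G 2‖ ^ 2 - b ^ 2) ^ 2 + (‖G 3‖ ^ 2 - b ^ 2) ^ 2
    + (|inner ℝ (G 0) (G 2)| + |inner ℝ (G 0) (G 3)|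
      + |inner ℝ (G 1) (G 2)| + |inner ℝ (G 1) (G 3)|) := by positivity
  linarith

theorem sq_le_bracket_one (a b : ℝ) (G : Quad) : (‖G 1‖ ^ 2 - a ^ 2) ^ 2 ≤ bracket a b G := by
  unfold bracket
  have : 0 ≤ (‖G 0‖ ^ 2 - a ^ 2) ^ 2 + (‖G 2‖ ^ 2 - b ^ 2) ^ 2 + (‖G 3‖ ^ 2 - b ^ 2) ^ 2
    + (|inner ℝ (G 0) (G 2)| + |inner ℝ (G 0) (G 3)|
      + |inner ℝ (G 1) (G 2)| + |inner ℝ (G 1) (G 3)|) := by positivity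
  linarith

theorem sq_le_bracket_two (a b : ℝ) (G : Quad) : (‖G 2‖ ^ 2 - b ^ 2) ^ 2 ≤ bracket a b G := by
  unfold bracket
  have : 0 ≤ (‖G 0‖ ^ 2 - a ^ 2) ^ 2 + (‖G 1‖ ^ 2 - a ^ 2) ^ 2 + (‖G 3‖ ^ 2 - b ^ 2) ^ 2
    + (|inner ℝ (G 0) (G 2)| + |inner ℝ (G 0) (G 3)|
      + |inner ℝ (G 1) (G 2)| + |inner ℝ (G 1) (G 3)|) := by positivity
  linarith

theorem sq_le_bracket_three (a b : ℝ) (G : Quad) :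
    (‖G 3‖ ^ 2 - b ^ 2) ^ 2 ≤ bracket a b G := by
  unfold bracket
  have : 0 ≤ (‖G 0‖ ^ 2 - a ^ 2) ^ 2 + (‖G 1‖ ^ 2 - a ^ 2) ^ 2 + (‖G 2‖ ^ 2 - b ^ 2) ^ 2
    + (|inner ℝ (G 0) (G 2)| + |inner ℝ (G 0) (G 3)|
      + |inner ℝ (G 1) (G 2)| + |inner ℝ (G 1) (G 3)|) := by positivity
  linarith

/-- Both brackets contain the length of the bond `G 0`, so they add up to at least the gap and the
larger one has at least half of it. -/
theorem half_gap_le_bracket {a b : ℝ} {G : Quad} (h : bracket a b G ≤ bracket b a G) :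
    gap a b / 2 ≤ bracket b a G := by
  have := gap_le_add_sq a b (‖G 0‖ ^ 2)
  have := sq_le_bracket_zero a b G
  have := sq_le_bracket_zero b a G
  linarith

section Density

variable {a b cbar : ℝ} {g : ℝ → ℝ} {k : Quad → ℝ}

theorem density_nonneg (hg : IsCutoff cbar g) (hk : HasQuadraticGrowth k) (G : Quad) :
    0 ≤ density a b g k G := by
  obtain ⟨c₁, c₂, hc₁, -, h⟩ := hk.bounds
  have h1 := (hg.mem_Icc ‖G‖).1
  have h2 := (hg.mem_Icc ‖G‖).2
  have h3 : 0 ≤ k G := le_trans (by positivity) (h G).1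
  exact add_nonneg (mul_nonneg h1 (mul_nonneg (bracket_nonneg _ _ _) (bracket_nonneg _ _ _)))
    (mul_nonneg (by linarith) h3)

/-- Beyond the truncation radius the density is `k`, which grows quadratically; inside it the norm
is bounded. -/
theorem exists_norm_sq_le_density (a b : ℝ) (hg : IsCutoff cbar g) (hk : HasQuadraticGrowth k) :
    ∃ K : ℝ, 0 ≤ K ∧ ∀ G, ‖G‖ ^ 2 ≤ K * (1 + density a b g k G) := by
  obtain ⟨c₁, c₂, hc₁, -, h⟩ := hk.bounds
  refine ⟨(20 * (cbar + 1)) ^ 2 + 1 / c₁, by positivity, fun G => ?_⟩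
  have h0 := density_nonneg (a := a) (b := b) hg hk G
  rcases le_total (20 * (cbar + 1)) ‖G‖ with hG | hG
  · have h1 : density a b g k G = k G := by
      rw [density, hg.eq_zero _ (by rwa [abs_norm])]; ring
    rw [h1] at h0 ⊢
    have h2 : ‖G‖ ^ 2 ≤ 1 / c₁ * k G := by
      rw [one_div, ← div_eq_inv_mul, le_div_iff₀ hc₁, mul_comm]
      exact (h G).1
    have : 0 ≤ (20 * (cbar + 1)) ^ 2 * (1 + k G) := by positivity
    have : 0 ≤ 1 / c₁ := by positivity
    linarith
  · have h1 : ‖G‖ ^ 2 ≤ (20 * (cbar + 1)) ^ 2 := pow_le_pow_left₀ (norm_nonneg _) hG 2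
    have : 0 ≤ (20 * (cbar + 1)) ^ 2 * density a b g k G := by positivity
    have : 0 ≤ 1 / c₁ * (1 + density a b g k G) := by positivity
    linarith

/-- Where the first bracket is the smaller one, it is controlled by the density, except for the
region of large stencils, where the squared norm is controlled. -/
theorem exists_add_le_density (ha : 0 < a) (hb : 0 < b) (hne : a ≠ b) (hg : IsCutoff cbar g)
    (hk : HasQuadraticGrowth k) :
    ∃ c : ℝ, 0 < c ∧ ∀ G, bracket a b G ≤ bracket b a G →
      c * (g ‖G‖ * bracket a b G + (1 - g ‖G‖) * ‖G‖ ^ 2) ≤ density a b g k G := by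
  obtain ⟨c₁, c₂, hc₁, -, h⟩ := hk.bounds
  have hgap := gap_pos ha hb hne
  -- The first entry bounds the larger bracket from below, the second is the growth constant of `k`.
  refine ⟨min (gap a b / 2) c₁, by positivity, fun G hG => ?_⟩
  have h1 := (hg.mem_Icc ‖G‖).1
  have h2 := (hg.mem_Icc ‖G‖).2
  have h3 := bracket_nonneg a b G
  have h4 := half_gap_le_bracket hG
  rw [mul_add, density, modelDensity]
  apply add_le_add
  · rw [mul_left_comm]
    apply mul_le_mul_of_nonneg_left _ h1
    rw [mul_comm]
    exact mul_le_mul_of_nonneg_left ((min_le_left _ _).trans h4) h3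
  · rw [mul_left_comm]
    apply mul_le_mul_of_nonneg_left _ (by linarith)
    exact (mul_le_mul_of_nonneg_right (min_le_right _ _) (by positivity)).trans (h G).1

/-- The squared distance is split with weights `g ‖G‖` and `1 - g ‖G‖`, to match the two terms of
`exists_add_le_density`: the bracket controls the first part, and the second is bounded by a
multiple of `‖G‖²`, as `‖G‖ ≥ 1` where its weight is nonzero. The components 0, 2 and 1, 3 are the
columns of the gradient on the triangles opening to the upper right and lower left of the grid
point. -/
theorem exists_distWell_sq_le_density (ha : 0 < a) (hb : 0 < b) (hne : a ≠ b)
    (hc : 0 ≤ cbar) (hg : IsCutoff cbar g) (hk : HasQuadraticGrowth k) :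
    ∃ K : ℝ, 0 ≤ K ∧ ∀ G, bracket a b G ≤ bracket b a G →
      (0 < det2 (G 0) (G 2) →
        distWell (columns (G 0) (G 2)) (U a b) ^ 2 ≤ K * density a b g k G) ∧
      (0 < det2 (G 1) (G 3) →
        distWell (columns (G 1) (G 3)) (U a b) ^ 2 ≤ K * density a b g k G) := by
  obtain ⟨c, hc0, hlow⟩ := exists_add_le_density ha hb hne hg hk
  obtain ⟨K₁, hK₁, hwell⟩ := exists_distWell_columns_sq_le ha hb
  set K₂ := 2 + 2 * (a ^ 2 + b ^ 2)
  have main : ∀ (G : Quad) (v w : Plane), bracket a b G ≤ bracket b a G → 0 < det2 v w →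
      (‖v‖ ^ 2 - a ^ 2) ^ 2 + (‖w‖ ^ 2 - b ^ 2) ^ 2 + |inner ℝ v w| ≤ bracket a b G →
      ‖v‖ ^ 2 + ‖w‖ ^ 2 ≤ ‖G‖ ^ 2 →
      distWell (columns v w) (U a b) ^ 2 ≤ ((K₁ + K₂) / c) * density a b g k G := by
    intro G v w hG hdet h1 h2
    have hg1 := (hg.mem_Icc ‖G‖).1
    have hg2 := (hg.mem_Icc ‖G‖).2
    have hB := bracket_nonneg a b G
    have hK₂ : 0 ≤ K₂ := by positivity
    have e1 : distWell (columns v w) (U a b) ^ 2 ≤ (K₁ + K₂) * bracket a b G :=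
      (hwell v w hdet).trans (mul_le_mul (by linarith) h1 (by positivity) (by positivity))
    have e2 : (1 - g ‖G‖) * distWell (columns v w) (U a b) ^ 2 ≤
        (1 - g ‖G‖) * ((K₁ + K₂) * ‖G‖ ^ 2) := by
      rcases le_or_gt ‖G‖ (10 * (cbar + 1)) with hle | hgt
      · rw [hg.eq_one _ (by rwa [abs_norm])]; simp
      · apply mul_le_mul_of_nonneg_left _ (by linarith)
        have hone : 1 ≤ ‖G‖ ^ 2 := one_le_pow₀ (by linarith)
        have := distWell_columns_sq_le a b v w
        have : 2 * (a ^ 2 + b ^ 2) * 1 ≤ 2 * (a ^ 2 + b ^ 2) * ‖G‖ ^ 2 :=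
          mul_le_mul_of_nonneg_left hone (by positivity)
        have : 0 ≤ K₁ * ‖G‖ ^ 2 := by positivity
        simp only [K₂]
        linarith
    rw [div_mul_eq_mul_div, le_div_iff₀ hc0]
    calc distWell (columns v w) (U a b) ^ 2 * c
        = c * (g ‖G‖ * distWell (columns v w) (U a b) ^ 2 +
            (1 - g ‖G‖) * distWell (columns v w) (U a b) ^ 2) := by ring
      _ ≤ c * (g ‖G‖ * ((K₁ + K₂) * bracket a b G) + (1 - g ‖G‖) * ((K₁ + K₂) * ‖G‖ ^ 2)) := by
          gcongr
      _ = (K₁ + K₂) * (c * (g ‖G‖ * bracket a b G + (1 - g ‖G‖) * ‖G‖ ^ 2)) := by ring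
      _ ≤ _ := mul_le_mul_of_nonneg_left (hlow G hG) (by positivity)
  refine ⟨(K₁ + K₂) / c, by positivity, fun G hG => ⟨fun hd => ?_, fun hd => ?_⟩⟩
  · apply main G _ _ hG hd
    · unfold bracket
      have : 0 ≤ (‖G 1‖ ^ 2 - a ^ 2) ^ 2 + (‖G 3‖ ^ 2 - b ^ 2) ^ 2 + (|inner ℝ (G 0) (G 3)|
        + |inner ℝ (G 1) (G 2)| + |inner ℝ (G 1) (G 3)|) := by positivity
      linarith
    · rw [quad_norm_sq]; linarith [sq_nonneg ‖G 1‖, sq_nonneg ‖G 3‖]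
  · apply main G _ _ hG hd
    · unfold bracket
      have : 0 ≤ (‖G 0‖ ^ 2 - a ^ 2) ^ 2 + (‖G 2‖ ^ 2 - b ^ 2) ^ 2 + (|inner ℝ (G 0) (G 3)|
        + |inner ℝ (G 1) (G 2)| + |inner ℝ (G 0) (G 2)|) := by positivity
      linarith
    · rw [quad_norm_sq]; linarith [sq_nonneg ‖G 0‖, sq_nonneg ‖G 2‖]

/-- Two stencils in different phases which share a bond cannot both have small energy. -/
theorem exists_le_density_of_jump (ha : 0 < a) (hb : 0 < b) (hne : a ≠ b)
    (hc : 0 ≤ cbar) (hg : IsCutoff cbar g) (hk : HasQuadraticGrowth k) :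
    ∃ δ : ℝ, 0 < δ ∧ ∀ G G', bracket a b G ≤ bracket b a G → bracket b a G' ≤ bracket a b G' →
      (‖G 0‖ = ‖G' 1‖ ∨ ‖G 1‖ = ‖G' 0‖ ∨ ‖G 2‖ = ‖G' 3‖ ∨ ‖G 3‖ = ‖G' 2‖) →
      δ ≤ density a b g k G ∨ δ ≤ density a b g k G' := by
  obtain ⟨c, hc0, hlow⟩ := exists_add_le_density ha hb hne hg hk
  obtain ⟨c', hc0', hlow'⟩ := exists_add_le_density hb ha hne.symm hg hk
  rw [density_comm b a] at hlow'
  have hgap := gap_pos ha hb hne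
  -- The entry 1 is the lower bound for `‖G‖²` where the cut-off is not 1, so the convex combination
  -- in `key` is at least `m` in every case.
  set m := min (gap a b / 2) 1
  have hm : 0 < m := by positivity
  have key : ∀ (c x : ℝ) (G : Quad), 0 < c → m ≤ x →
      c * m ≤ c * (g ‖G‖ * x + (1 - g ‖G‖) * ‖G‖ ^ 2) := by
    intro c x G hc0 hx
    apply mul_le_mul_of_nonneg_left _ hc0.le
    have hg1 := (hg.mem_Icc ‖G‖).1
    have hg2 := (hg.mem_Icc ‖G‖).2
    rcases le_or_gt ‖G‖ (10 * (cbar + 1)) with hle | hgt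
    · rw [hg.eq_one _ (by rwa [abs_norm])]; simpa
    · have hone : 1 ≤ ‖G‖ ^ 2 := one_le_pow₀ (by linarith)
      have hm1 : m ≤ 1 := min_le_right _ _
      nlinarith [mul_le_mul_of_nonneg_left hx hg1,
        mul_le_mul_of_nonneg_left (hm1.trans hone) (sub_nonneg.mpr hg2)]
  refine ⟨min (c * m) (c' * m), by positivity, fun G G' hG hG' hbond => ?_⟩
  -- The shared bond is compared with one of `a`, `b` in the first bracket and with the other in the
  -- second.
  have hsum : gap a b ≤ bracket a b G + bracket b a G' := by
    rcases hbond with h | h | h | h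
    · have h1 := sq_le_bracket_zero a b G
      have h2 := sq_le_bracket_one b a G'
      rw [← h] at h2
      linarith [gap_le_add_sq a b (‖G 0‖ ^ 2)]
    · have h1 := sq_le_bracket_one a b G
      have h2 := sq_le_bracket_zero b a G'
      rw [← h] at h2
      linarith [gap_le_add_sq a b (‖G 1‖ ^ 2)]
    · have h1 := sq_le_bracket_two a b G
      have h2 := sq_le_bracket_three b a G'
      rw [← h] at h2
      linarith [gap_le_add_sq a b (‖G 2‖ ^ 2)]
    · have h1 := sq_le_bracket_three a b G
      have h2 := sq_le_bracket_two b a G'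
      rw [← h] at h2
      linarith [gap_le_add_sq a b (‖G 3‖ ^ 2)]
  have hm2 : m ≤ gap a b / 2 := min_le_left _ _
  rcases le_or_gt (gap a b / 2) (bracket a b G) with h | h
  · left
    exact (min_le_left _ _).trans ((key c _ G hc0 (hm2.trans h)).trans (hlow G hG))
  · right
    exact (min_le_right _ _).trans
      ((key c' (bracket b a G') G' hc0' (by linarith)).trans (hlow' G' hG'))

end Density

/-! ### Grid cells -/

/-- The index of the square of side `1/n` that contains `x`. -/
def cell (n : ℕ) (x : Plane) : ℤ × ℤ := (⌊n * x 0⌋, ⌊n * x 1⌋)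

/-- The union of the squares of side `1/n` with index in `P`. -/
def gridSet (n : ℕ) (P : Set (ℤ × ℤ)) : Set Plane := cell n ⁻¹' P

theorem measurable_coord (i : Fin 2) : Measurable fun x : Plane => x i :=
  (EuclideanSpace.proj (𝕜 := ℝ) i).continuous.measurable

theorem measurable_cell (n : ℕ) : Measurable (cell n) :=
  ((measurable_coord 0).const_mul _).floor.prodMk ((measurable_coord 1).const_mul _).floor

theorem measurableSet_gridSet (n : ℕ) (P : Set (ℤ × ℤ)) : MeasurableSet (gridSet n P) :=
  measurable_cell n (Set.to_countable P).measurableSet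

theorem volume_coord_mem (A B : Set ℝ) (hA : MeasurableSet A) (hB : MeasurableSet B) :
    volume {x : Plane | x 0 ∈ A ∧ x 1 ∈ B} = volume A * volume B := by
  have h := (PiLp.volume_preserving_ofLp (Fin 2)).measure_preimage
    (MeasurableSet.univ_pi (t := ![A, B]) (by intro i; fin_cases i <;> simpa)).nullMeasurableSet
  rw [volume_pi_pi, Fin.prod_univ_two] at h
  simp only [Matrix.cons_val_zero, Matrix.cons_val_one] at h
  rw [← h]
  congr 1
  ext x
  simp [Fin.forall_fin_two]

theorem floor_mul_eq_iff {n : ℕ} (hn : 1 ≤ n) (x : ℝ) (i : ℤ) :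
    ⌊n * x⌋ = i ↔ x ∈ Set.Ico ((i : ℝ) / n) ((i + 1) / n) := by
  have hpos : (0 : ℝ) < n := by exact_mod_cast hn
  rw [Int.floor_eq_iff, Set.mem_Ico, div_le_iff₀' hpos, lt_div_iff₀' hpos]

theorem volume_cell {n : ℕ} (hn : 1 ≤ n) (p : ℤ × ℤ) :
    volume (cell n ⁻¹' {p}) = ENNReal.ofReal (1 / (n : ℝ) ^ 2) := by
  have h : cell n ⁻¹' {p} = {x : Plane | x 0 ∈ Set.Ico ((p.1 : ℝ) / n) ((p.1 + 1) / n) ∧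
      x 1 ∈ Set.Ico ((p.2 : ℝ) / n) ((p.2 + 1) / n)} := by
    ext x
    simp only [Set.mem_preimage, Set.mem_singleton_iff, cell, Prod.ext_iff, floor_mul_eq_iff hn,
      Set.mem_ofPred_eq]
  rw [h, volume_coord_mem _ _ measurableSet_Ico measurableSet_Ico, Real.volume_Ico,
    Real.volume_Ico, ← ENNReal.ofReal_mul (by rw [← sub_div]; simp)]
  congr 1
  field_simp
  ring

/-- The map `cell n` pushes Lebesgue measure forward to `n⁻²` times counting measure. -/
theorem lintegral_cell {n : ℕ} (hn : 1 ≤ n) (f : ℤ × ℤ → ℝ≥0∞) :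
    ∫⁻ x, f (cell n x) = ENNReal.ofReal (1 / (n : ℝ) ^ 2) * ∑' p, f p := by
  rw [← lintegral_map (measurable_of_countable f) (measurable_cell n), lintegral_countable',
    ← ENNReal.tsum_mul_left]
  congr 1
  ext p
  rw [Measure.map_apply (measurable_cell n) (measurableSet_singleton p), volume_cell hn, mul_comm]

theorem volume_gridSet_le {n : ℕ} (hn : 1 ≤ n) (S : Finset (ℤ × ℤ)) {P : Set (ℤ × ℤ)}
    (hP : P ⊆ S) : volume (gridSet n P) ≤ ENNReal.ofReal (S.card / (n : ℝ) ^ 2) := by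
  have h1 : gridSet n P ⊆ ⋃ p ∈ S, cell n ⁻¹' {p} := by
    intro x hx
    simp only [Set.mem_iUnion]
    exact ⟨cell n x, hP hx, rfl⟩
  refine (measure_mono h1).trans ((measure_biUnion_finset_le _ _).trans ?_)
  simp only [volume_cell hn, Finset.sum_const, nsmul_eq_mul]
  rw [← ENNReal.ofReal_natCast, ← ENNReal.ofReal_mul (by positivity), mul_one_div]

/-! ### Translation bounds -/

/-- The measure of the difference between `E` and its translate by `-t`. -/
def shiftDiff (E : Set Plane) (t : Plane) : ℝ≥0∞ := volume (E ∆ ((· + t) ⁻¹' E))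

/-- Triangle inequality through the translate by `s`, and translation invariance of the measure. -/
theorem shiftDiff_add (E : Set Plane) (s t : Plane) :
    shiftDiff E (s + t) ≤ shiftDiff E s + shiftDiff E t := by
  have h : shiftDiff E t = volume (((· + s) ⁻¹' E) ∆ ((· + (s + t)) ⁻¹' E)) := by
    rw [shiftDiff, ← measure_preimage_add_right volume s (E ∆ _), Set.preimage_symmDiff]
    simp only [Set.preimage_preimage, add_assoc]
  rw [h]
  exact measure_symmDiff_le _ _ _

theorem shiftDiff_neg (E : Set Plane) (t : Plane) : shiftDiff E (-t) = shiftDiff E t := by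
  rw [shiftDiff, ← measure_preimage_add_right volume t, Set.preimage_symmDiff, symmDiff_comm,
    shiftDiff]
  simp [Set.preimage_preimage, add_assoc]

/-- `E` changes by at most `C (|t₀| + |t₁|)` in measure under translation by `t`. -/
def HasTranslationBound (C : ℝ) (E : Set Plane) : Prop :=
  ∀ t : Plane, shiftDiff E t ≤ ENNReal.ofReal (C * (|t 0| + |t 1|))

/-- Subadditivity splits a translation into its axis-parallel parts; the symmetry under `t ↦ -t`
leaves only nonnegative steps. -/
theorem hasTranslationBound_of_axes {C : ℝ} (hC : 0 ≤ C) {E : Set Plane}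
    (h0 : ∀ τ : ℝ, 0 ≤ τ → shiftDiff E !₂[τ, 0] ≤ ENNReal.ofReal (C * τ))
    (h1 : ∀ τ : ℝ, 0 ≤ τ → shiftDiff E !₂[0, τ] ≤ ENNReal.ofReal (C * τ)) :
    HasTranslationBound C E := by
  intro t
  have ht : t = !₂[t 0, 0] + !₂[0, t 1] := by
    ext i; fin_cases i <;> simp
  have h0' : ∀ τ : ℝ, shiftDiff E !₂[τ, 0] ≤ ENNReal.ofReal (C * |τ|) := by
    intro τ
    rcases le_total 0 τ with h | h
    · rw [abs_of_nonneg h]; exact h0 τ h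
    · rw [abs_of_nonpos h, ← shiftDiff_neg]
      convert h0 (-τ) (by linarith) using 2
      ext i; fin_cases i <;> simp
  have h1' : ∀ τ : ℝ, shiftDiff E !₂[0, τ] ≤ ENNReal.ofReal (C * |τ|) := by
    intro τ
    rcases le_total 0 τ with h | h
    · rw [abs_of_nonneg h]; exact h1 τ h
    · rw [abs_of_nonpos h, ← shiftDiff_neg]
      convert h1 (-τ) (by linarith) using 2
      ext i; fin_cases i <;> simp
  rw [mul_add, ENNReal.ofReal_add (by positivity) (by positivity)]
  conv_lhs => rw [ht]
  exact (shiftDiff_add _ _ _).trans (add_le_add (h0' _) (h1' _))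

theorem HasTranslationBound.mono {C C' : ℝ} {E : Set Plane} (h : HasTranslationBound C E)
    (hC : C ≤ C') : HasTranslationBound C' E := fun t =>
  (h t).trans (ENNReal.ofReal_le_ofReal (mul_le_mul_of_nonneg_right hC (by positivity)))

/-- Translation bounds pass to limits in measure. -/
theorem HasTranslationBound.of_tendsto {C : ℝ} {S : ℕ → Set Plane} {E : Set Plane}
    (hS : ∀ n, HasTranslationBound C (S n))
    (hlim : Tendsto (fun n => volume (S n ∆ E)) atTop (𝓝 0)) : HasTranslationBound C E := by
  intro t
  have h1 : ∀ n, shiftDiff E t ≤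
      volume (S n ∆ E) + ENNReal.ofReal (C * (|t 0| + |t 1|)) + volume (S n ∆ E) := by
    intro n
    have h2 : volume (((· + t) ⁻¹' S n) ∆ ((· + t) ⁻¹' E)) = volume (S n ∆ E) := by
      rw [← Set.preimage_symmDiff, measure_preimage_add_right]
    calc shiftDiff E t ≤ volume (E ∆ S n) + volume (S n ∆ ((· + t) ⁻¹' E)) :=
          measure_symmDiff_le _ _ _
      _ ≤ volume (E ∆ S n) + (volume (S n ∆ ((· + t) ⁻¹' S n)) +
            volume (((· + t) ⁻¹' S n) ∆ ((· + t) ⁻¹' E))) := by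
          gcongr; exact measure_symmDiff_le _ _ _
      _ ≤ _ := by
          rw [h2, symmDiff_comm E, ← add_assoc]
          gcongr
          exact hS n t
  refine ge_of_tendsto' (x := atTop) (b := shiftDiff E t) ?_ h1
  have := (hlim.add_const (ENNReal.ofReal (C * (|t 0| + |t 1|)))).add hlim
  simpa using this

theorem exists_jump (A : ℤ → Prop) {i i' : ℤ} (hle : i ≤ i') (hne : ¬(A i ↔ A i')) :
    ∃ l, i ≤ l ∧ l < i' ∧ ¬(A l ↔ A (l + 1)) := by
  by_contra! h
  apply hne
  have : ∀ m, i ≤ m → m ≤ i' → (A i ↔ A m) := by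
    intro m hm
    induction m, hm using Int.leInduction with
    | base => simp
    | succ m hm ih => intro hm'; exact (ih (by omega)).trans (h m hm (by omega))
  exact this i' hle le_rfl

/-- Each pair of adjacent grid squares at which a union of squares has an interface contributes
at most the length `1/n` to the translation bound. -/
theorem hasTranslationBound_gridSet {n : ℕ} (hn : 1 ≤ n) {P : Set (ℤ × ℤ)}
    (S : Finset (ℤ × ℤ)) (h0 : ∀ i j, ¬((i, j) ∈ P ↔ (i + 1, j) ∈ P) → (i, j) ∈ S)
    (h1 : ∀ i j, ¬((i, j) ∈ P ↔ (i, j + 1) ∈ P) → (i, j) ∈ S) :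
    HasTranslationBound (S.card / n) (gridSet n P) := by
  have hpos : (0 : ℝ) < n := by exact_mod_cast hn
  have hside : ∀ i : ℤ, ((i : ℝ) + 1) / n - i / n = 1 / n := fun i => by ring
  apply hasTranslationBound_of_axes (by positivity)
  · intro τ hτ
    -- The segment from `x` to its translate must cross the right side of some square with index in
    -- `S`. Such `x` fill a rectangle of width `τ` and height `1/n` to the left of that side.
    have hsub : gridSet n P ∆ ((· + !₂[τ, 0]) ⁻¹' gridSet n P) ⊆ ⋃ p ∈ S, {x : Plane |
        x 0 ∈ Set.Ico (((p.1 : ℝ) + 1) / n - τ) (((p.1 : ℝ) + 1) / n) ∧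
        x 1 ∈ Set.Ico ((p.2 : ℝ) / n) ((p.2 + 1) / n)} := by
      intro x hx
      have hx' : ¬((⌊n * x 0⌋, ⌊n * x 1⌋) ∈ P ↔ (⌊n * (x 0 + τ)⌋, ⌊n * x 1⌋) ∈ P) := by
        rw [Set.mem_symmDiff] at hx
        simp only [gridSet, cell, Set.mem_preimage, PiLp.add_apply,
          Matrix.cons_val_zero, Matrix.cons_val_one, add_zero] at hx
        tauto
      obtain ⟨l, hl1, hl2, hl3⟩ := exists_jump (fun i => (i, ⌊n * x 1⌋) ∈ P)
        (Int.floor_mono (by nlinarith : n * x 0 ≤ n * (x 0 + τ))) hx'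
      simp only [Set.mem_iUnion]
      refine ⟨(l, ⌊n * x 1⌋), h0 _ _ hl3, ⟨?_, ?_⟩, (floor_mul_eq_iff hn _ _).mp rfl⟩
      · rw [sub_le_iff_le_add, div_le_iff₀' hpos]
        have : ((l + 1 : ℤ) : ℝ) ≤ n * (x 0 + τ) := Int.le_floor.mp (by omega)
        exact_mod_cast this
      · rw [lt_div_iff₀' hpos]
        have : n * x 0 < ((l + 1 : ℤ) : ℝ) := Int.floor_lt.mp (by omega)
        exact_mod_cast this
    refine (measure_mono hsub).trans ((measure_biUnion_finset_le _ _).trans ?_)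
    simp only [volume_coord_mem _ _ measurableSet_Ico measurableSet_Ico, Real.volume_Ico,
      sub_sub_cancel, hside, Finset.sum_const, nsmul_eq_mul]
    rw [← ENNReal.ofReal_natCast, ← ENNReal.ofReal_mul hτ, ← ENNReal.ofReal_mul (by positivity)]
    exact le_of_eq (by congr 1; ring)
  · intro τ hτ
    have hsub : gridSet n P ∆ ((· + !₂[0, τ]) ⁻¹' gridSet n P) ⊆ ⋃ p ∈ S, {x : Plane |
        x 0 ∈ Set.Ico ((p.1 : ℝ) / n) ((p.1 + 1) / n) ∧
        x 1 ∈ Set.Ico (((p.2 : ℝ) + 1) / n - τ) (((p.2 : ℝ) + 1) / n)} := by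
      intro x hx
      have hx' : ¬((⌊n * x 0⌋, ⌊n * x 1⌋) ∈ P ↔ (⌊n * x 0⌋, ⌊n * (x 1 + τ)⌋) ∈ P) := by
        rw [Set.mem_symmDiff] at hx
        simp only [gridSet, cell, Set.mem_preimage, PiLp.add_apply,
          Matrix.cons_val_zero, Matrix.cons_val_one, add_zero] at hx
        tauto
      obtain ⟨l, hl1, hl2, hl3⟩ := exists_jump (fun j => (⌊n * x 0⌋, j) ∈ P)
        (Int.floor_mono (by nlinarith : n * x 1 ≤ n * (x 1 + τ))) hx'
      simp only [Set.mem_iUnion]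
      refine ⟨(⌊n * x 0⌋, l), h1 _ _ hl3, (floor_mul_eq_iff hn _ _).mp rfl, ⟨?_, ?_⟩⟩
      · rw [sub_le_iff_le_add, div_le_iff₀' hpos]
        have : ((l + 1 : ℤ) : ℝ) ≤ n * (x 1 + τ) := Int.le_floor.mp (by omega)
        exact_mod_cast this
      · rw [lt_div_iff₀' hpos]
        have : n * x 1 < ((l + 1 : ℤ) : ℝ) := Int.floor_lt.mp (by omega)
        exact_mod_cast this
    refine (measure_mono hsub).trans ((measure_biUnion_finset_le _ _).trans ?_)
    simp only [volume_coord_mem _ _ measurableSet_Ico measurableSet_Ico, Real.volume_Ico,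
      sub_sub_cancel, hside, Finset.sum_const, nsmul_eq_mul]
    rw [← ENNReal.ofReal_natCast, ← ENNReal.ofReal_mul (by positivity),
      ← ENNReal.ofReal_mul (by positivity)]
    exact le_of_eq (by congr 1; ring)

/-! ### Translation bounds imply finite perimeter -/

theorem setIntegral_sub_le {f : Plane → ℝ} (hf : Integrable f) (hf1 : ∀ x, |f x| ≤ 1)
    {A B : Set Plane} (hA : MeasurableSet A) (hB : MeasurableSet B) {c : ℝ} (hc : 0 ≤ c)
    (h : volume (A ∆ B) ≤ ENNReal.ofReal c) :
    (∫ x in A, f x) - ∫ x in B, f x ≤ c := by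
  have hfin : volume (A ∆ B) < ⊤ := h.trans_lt ENNReal.ofReal_lt_top
  have h1 := integral_inter_add_sdiff (μ := volume) (f := f) (s := A) hB hf.integrableOn
  have h2 := integral_inter_add_sdiff (μ := volume) (f := f) (s := B) hA hf.integrableOn
  have hAB : volume (A \ B) < ⊤ := (measure_mono Set.subset_union_left).trans_lt hfin
  have hBA : volume (B \ A) < ⊤ := (measure_mono Set.subset_union_right).trans_lt hfin
  have h3 := norm_setIntegral_le_of_norm_le_const (μ := volume) (f := f) (C := 1) hAB
    (fun x _ => hf1 x)
  have h4 := norm_setIntegral_le_of_norm_le_const (μ := volume) (f := f) (C := 1) hBA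
    (fun x _ => hf1 x)
  have h5 : volume.real (A \ B) + volume.real (B \ A) ≤ c := by
    rw [← measureReal_union disjoint_sdiff_sdiff (hB.diff hA) hAB.ne hBA.ne]
    exact ENNReal.toReal_le_of_le_ofReal hc h
  rw [Set.inter_comm B A] at h2
  rw [Real.norm_eq_abs] at h3 h4
  have := (abs_le.mp h3).2
  have := (abs_le.mp h4).1
  linarith

/-- The derivative is a limit of difference quotients, dominated by the Lipschitz constant of `f`.
Moving the translation from `f` to `E` bounds each quotient by the measure of a symmetric difference
divided by the step, hence by `C`. -/
theorem setIntegral_fderiv_le {C : ℝ} {E : Set Plane} (hE : MeasurableSet E)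
    (hfin : volume E < ⊤) (hC : 0 ≤ C) (htr : HasTranslationBound C E) {f : Plane → ℝ}
    (hf : ContDiff ℝ 1 f) (hsupp : HasCompactSupport f) (hf1 : ∀ x, |f x| ≤ 1) (i : Fin 2) :
    ∫ x in E, fderiv ℝ f x (EuclideanSpace.single i 1) ≤ C := by
  set e : Plane := EuclideanSpace.single i 1 with he
  obtain ⟨L, hL⟩ := ContDiff.lipschitzWith_of_hasCompactSupport hsupp hf one_ne_zero
  have hint : Integrable f := hf.continuous.integrable_of_hasCompactSupport hsupp
  have hdiff : ∀ x, HasFDerivAt f (fderiv ℝ f x) x := fun x =>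
    (hf.differentiable one_ne_zero x).hasFDerivAt
  have hto : Tendsto (fun m : ℕ => ((m : ℝ) + 1)) atTop atTop :=
    tendsto_atTop_add_const_right _ _ tendsto_natCast_atTop_atTop
  have hlim : Tendsto (fun m : ℕ => ∫ x in E, ((m : ℝ) + 1) * (f (x + ((m : ℝ) + 1)⁻¹ • e) - f x))
      atTop (𝓝 (∫ x in E, fderiv ℝ f x e)) := by
    apply tendsto_integral_of_dominated_convergence (fun _ => (L : ℝ) * ‖e‖)
    · intro m
      have hc := hf.continuous
      exact (by fun_prop : Continuous fun x => ((m : ℝ) + 1) *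
        (f (x + ((m : ℝ) + 1)⁻¹ • e) - f x)).aestronglyMeasurable
    · exact integrableOn_const hfin.ne
    · intro m
      filter_upwards with x
      have hm : (0 : ℝ) < (m : ℝ) + 1 := by positivity
      have h1 := hL.dist_le_mul (x + ((m : ℝ) + 1)⁻¹ • e) x
      rw [dist_eq_norm, dist_eq_norm, add_sub_cancel_left, norm_smul, norm_inv,
        Real.norm_of_nonneg hm.le] at h1
      rw [norm_mul, Real.norm_of_nonneg hm.le]
      calc ((m : ℝ) + 1) * ‖f (x + ((m : ℝ) + 1)⁻¹ • e) - f x‖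
          ≤ ((m : ℝ) + 1) * (L * (((m : ℝ) + 1)⁻¹ * ‖e‖)) := by gcongr
        _ = L * ‖e‖ := by field_simp
    · filter_upwards with x
      have := (hdiff x).lim_real e
      exact this.comp hto
  refine le_of_tendsto' hlim fun m => ?_
  have hm : (0 : ℝ) < (m : ℝ) + 1 := by positivity
  set t : Plane := ((m : ℝ) + 1)⁻¹ • e with ht
  have hintt : Integrable fun x => f (x + t) := hint.comp_add_right t
  have hshift : ∫ x in E, f (x + t) = ∫ x in (· + -t) ⁻¹' E, f x := by
    have hE' : MeasurableSet ((· + -t) ⁻¹' E) := measurable_add_const (-t) hE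
    rw [← integral_indicator hE, ← integral_indicator hE',
      ← integral_add_right_eq_self (((· + -t) ⁻¹' E).indicator f) t]
    congr 1
    ext x
    have hx : x + t ∈ (· + -t) ⁻¹' E ↔ x ∈ E := by simp
    by_cases hxE : x ∈ E
    · rw [Set.indicator_of_mem hxE, Set.indicator_of_mem (hx.mpr hxE)]
    · rw [Set.indicator_of_notMem hxE, Set.indicator_of_notMem (mt hx.mp hxE)]
  rw [integral_const_mul, integral_sub hintt.integrableOn hint.integrableOn, hshift]
  have hsum : |t 0| + |t 1| = ((m : ℝ) + 1)⁻¹ := by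
    have h0 : ∀ j, t j = ((m : ℝ) + 1)⁻¹ * e j := fun j => rfl
    have hinv : |((m : ℝ) + 1)⁻¹| = ((m : ℝ) + 1)⁻¹ := abs_of_pos (by positivity)
    rw [h0, h0, abs_mul, abs_mul, he, hinv]
    fin_cases i <;> simp
  have hb := htr t
  rw [hsum, ← shiftDiff_neg, shiftDiff, symmDiff_comm] at hb
  have h := setIntegral_sub_le hint hf1 (measurable_add_const (-t) hE) hE (by positivity) hb
  calc ((m : ℝ) + 1) * _ ≤ ((m : ℝ) + 1) * (C * ((m : ℝ) + 1)⁻¹) := by gcongr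
    _ = C := by field_simp

/-- Each of the two partial derivatives in the divergence contributes at most `C`, so the perimeter
is at most `2C`. -/
theorem isCaccioppoli_of_hasTranslationBound {C : ℝ} {E : Set Plane} (hE : MeasurableSet E)
    (hfin : volume E < ⊤) (hC : 0 ≤ C) (htr : HasTranslationBound C E) : IsCaccioppoli E := by
  refine ⟨hE, lt_of_le_of_lt ?_ (ENNReal.ofReal_lt_top (r := C + C))⟩
  refine iSup_le fun X => iSup_le fun hX => iSup_le fun hsupp => iSup_le fun hX1 => ?_
  apply ENNReal.ofReal_le_ofReal
  have hcoord : ∀ i : Fin 2, ContDiff ℝ 1 fun x => X x i := fun i =>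
    (EuclideanSpace.proj (𝕜 := ℝ) i).contDiff.comp hX
  have hcs : ∀ i : Fin 2, HasCompactSupport fun x => X x i := fun i =>
    hsupp.comp_left (g := fun v : Plane => v i) rfl
  have hder : ∀ (i : Fin 2) (x v : Plane),
      (fderiv ℝ X x v) i = fderiv ℝ (fun x => X x i) x v := by
    intro i x v
    have h := ((EuclideanSpace.proj (𝕜 := ℝ) i).hasFDerivAt (x := X x)).comp x
      (hX.differentiable one_ne_zero x).hasFDerivAt
    have h2 : fderiv ℝ (fun x => X x i) x = _ := h.fderiv
    rw [h2]
    rfl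
  have hint : ∀ i : Fin 2, Integrable fun x =>
      fderiv ℝ (fun x => X x i) x (EuclideanSpace.single i 1) := by
    intro i
    have hc : Continuous fun x => fderiv ℝ (fun x => X x i) x (EuclideanSpace.single i 1) :=
      ((hcoord i).continuous_fderiv one_ne_zero).clm_apply continuous_const
    apply hc.integrable_of_hasCompactSupport
    exact ((hcs i).fderiv ℝ).comp_left (g := fun L => L (EuclideanSpace.single i 1)) rfl
  have hbd : ∀ (i : Fin 2) x, |X x i| ≤ 1 := fun i x =>
    (PiLp.norm_apply_le (X x) i).trans (hX1 x)
  have hdiv : ∀ x, divergence X x =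
      fderiv ℝ (fun x => X x 0) x (EuclideanSpace.single 0 1) +
      fderiv ℝ (fun x => X x 1) x (EuclideanSpace.single 1 1) := by
    intro x
    simp only [divergence, Fin.sum_univ_two, hder]
  simp only [hdiv]
  rw [integral_add (hint 0).integrableOn (hint 1).integrableOn]
  exact add_le_add
    (setIntegral_fderiv_le hE hfin hC htr (hcoord 0) (hcs 0) (hbd 0) 0)
    (setIntegral_fderiv_le hE hfin hC htr (hcoord 1) (hcs 1) (hbd 1) 1)

/-! ### Compactness of sets with a uniform translation bound -/

/-- The lower left corner of the grid square that contains `x`. -/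
def corner (m : ℕ) (x : Plane) : Plane := !₂[(⌊m * x 0⌋ : ℝ) / m, (⌊m * x 1⌋ : ℝ) / m]

theorem measurable_corner (m : ℕ) : Measurable (corner m) := by
  have h : corner m = (fun p : ℤ × ℤ => (!₂[(p.1 : ℝ) / m, (p.2 : ℝ) / m] : Plane)) ∘ cell m := by
    ext x; rfl
  rw [h]
  exact (measurable_of_countable _).comp (measurable_cell m)

theorem sub_corner_mem {m : ℕ} (hm : 1 ≤ m) (x : Plane) (i : Fin 2) :
    x i - corner m x i ∈ Set.Ico (0 : ℝ) (1 / m) := by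
  have hpos : (0 : ℝ) < m := by exact_mod_cast hm
  have key : ∀ y : ℝ, y - (⌊m * y⌋ : ℝ) / m ∈ Set.Ico (0 : ℝ) (1 / m) := by
    intro y
    have h := (floor_mul_eq_iff hm y _).mp rfl
    rw [Set.mem_Ico, add_div] at h
    exact ⟨by linarith [h.1], by linarith [h.2]⟩
  fin_cases i
  · exact key (x 0)
  · exact key (x 1)

/-- Replacing `E` by the union of those squares whose sample point (a fixed translate of the
corner) belongs to `E` changes little, for a suitable choice of the sample points. -/
theorem exists_sample {C : ℝ} (hC : 0 ≤ C) {E : Set Plane} (hE : MeasurableSet E)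
    (htr : HasTranslationBound C E) {m : ℕ} (hm : 1 ≤ m) :
    ∃ s : Plane, (∀ i, s i ∈ Set.Ico (0 : ℝ) (1 / m)) ∧
      volume (E ∆ {x | corner m x + s ∈ E}) ≤ ENNReal.ofReal ((8 * C + 1) / m) := by
  have hpos : (0 : ℝ) < m := by exact_mod_cast hm
  set r : ℝ := 1 / m with hr
  have hr0 : 0 < r := by positivity
  set B : Set Plane := {s | s 0 ∈ Set.Ico 0 r ∧ s 1 ∈ Set.Ico 0 r}
  set B' : Set Plane := {s | s 0 ∈ Set.Ioo (-r) r ∧ s 1 ∈ Set.Ioo (-r) r}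
  have hBm : MeasurableSet B :=
    (measurable_coord 0 measurableSet_Ico).inter (measurable_coord 1 measurableSet_Ico)
  have hB'm : MeasurableSet B' :=
    (measurable_coord 0 measurableSet_Ioo).inter (measurable_coord 1 measurableSet_Ioo)
  have hvB : volume B = ENNReal.ofReal (r * r) := by
    rw [volume_coord_mem _ _ measurableSet_Ico measurableSet_Ico, Real.volume_Ico, sub_zero,
      ENNReal.ofReal_mul hr0.le]
  have hvB' : volume B' = ENNReal.ofReal (4 * (r * r)) := by
    rw [volume_coord_mem _ _ measurableSet_Ioo measurableSet_Ioo, Real.volume_Ioo,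
      ← ENNReal.ofReal_mul (by linarith)]
    congr 1; ring
  -- Averaging over the sample point: if every `s` failed, integration over the box `B` of area `r²`
  -- would give at least `(8C + 1) r³`, while Fubini and the translation bound give at most `2Cr ·
  -- 4r² = 8C r³`.
  by_contra! hcon
  have hcon' : ∀ s ∈ B, ENNReal.ofReal ((8 * C + 1) / m) ≤
      volume (E ∆ {x | corner m x + s ∈ E}) := fun s hs =>
    (hcon s (by intro i; fin_cases i; exacts [hs.1, hs.2])).le
  set T : Set (Plane × Plane) := {z | z.1 ∈ E ∆ ((· + z.2) ⁻¹' E)} with hT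
  have hTm : MeasurableSet T := by
    have h1 : MeasurableSet {z : Plane × Plane | z.1 ∈ E} := measurable_fst hE
    have h2 : MeasurableSet {z : Plane × Plane | z.1 + z.2 ∈ E} :=
      (measurable_fst.add measurable_snd) hE
    exact h1.symmDiff h2
  set σ : Plane → Plane → ℝ≥0∞ := fun x t => T.indicator 1 (x, t) with hσ
  have hσm : Measurable fun z : Plane × Plane => T.indicator (1 : Plane × Plane → ℝ≥0∞) z :=
    measurable_one.indicator hTm
  have hσt : ∀ t, ∫⁻ x, σ x t = shiftDiff E t := by
    intro t
    have hm : MeasurableSet (E ∆ ((· + t) ⁻¹' E)) := hE.symmDiff (measurable_add_const t hE)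
    rw [shiftDiff, ← lintegral_indicator_one hm]
    rfl
  have hsample : ∀ s, volume (E ∆ {x | corner m x + s ∈ E}) =
      ∫⁻ x, σ x (corner m x + s - x) := by
    intro s
    have hm : MeasurableSet (E ∆ {x | corner m x + s ∈ E}) :=
      hE.symmDiff (((measurable_corner m).add_const s) hE)
    rw [← lintegral_indicator_one hm]
    congr 1
    ext x
    have hx : x ∈ E ∆ {x | corner m x + s ∈ E} ↔ (x, corner m x + s - x) ∈ T := by
      simp only [hT, Set.mem_symmDiff, Set.mem_ofPred_eq, Set.mem_preimage, add_sub_cancel]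
    by_cases hxT : (x, corner m x + s - x) ∈ T
    · simp only [hσ, Set.indicator_of_mem hxT, Set.indicator_of_mem (hx.mpr hxT), Pi.one_apply]
    · simp only [hσ, Set.indicator_of_notMem hxT, Set.indicator_of_notMem (mt hx.mp hxT)]
  have hm1 : Measurable fun z : Plane × Plane => σ z.2 (corner m z.2 + z.1 - z.2) := by
    apply hσm.comp
    exact measurable_snd.prodMk
      ((((measurable_corner m).comp measurable_snd).add measurable_fst).sub measurable_snd)
  have h1 : ENNReal.ofReal ((8 * C + 1) / m) * volume B ≤
      ∫⁻ s in B, ∫⁻ x, σ x (corner m x + s - x) := by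
    rw [← setLIntegral_const]
    apply setLIntegral_mono' hBm
    intro s hs
    rw [← hsample]
    exact hcon' s hs
  have h2 : ∫⁻ s in B, ∫⁻ x, σ x (corner m x + s - x) =
      ∫⁻ x, ∫⁻ s in B, σ x (corner m x + s - x) :=
    lintegral_lintegral_swap hm1.aemeasurable
  -- Substitute `t = corner m x + s - x`; both `s` and `x - corner m x` have coordinates in `[0,
  -- r)`, so those of `t` lie in `(-r, r)`.
  have h3 : ∀ x, ∫⁻ s in B, σ x (corner m x + s - x) ≤ ∫⁻ t in B', σ x t := by
    intro x
    rw [← lintegral_indicator hBm, ← lintegral_indicator hB'm,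
      ← lintegral_add_right_eq_self (μ := volume) (B'.indicator fun t => σ x t)
        (corner m x - x)]
    apply lintegral_mono
    intro s
    by_cases hs : s ∈ B
    · have hs' : s + (corner m x - x) ∈ B' := by
        have h0 := sub_corner_mem hm x 0
        have h1 := sub_corner_mem hm x 1
        rw [← hr] at h0 h1
        obtain ⟨hs0, hs1⟩ := hs
        simp only [Set.mem_Ico] at h0 h1 hs0 hs1
        simp only [B', Set.mem_ofPred_eq, PiLp.add_apply, PiLp.sub_apply, Set.mem_Ioo]
        refine ⟨⟨?_, ?_⟩, ?_, ?_⟩ <;> linarith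
      refine le_of_eq ((Set.indicator_of_mem hs _).trans
        (Eq.trans ?_ (Set.indicator_of_mem hs' _).symm))
      congr 1
      abel
    · rw [Set.indicator_of_notMem hs]
      exact zero_le
  have h4 : ∫⁻ x, ∫⁻ t in B', σ x t = ∫⁻ t in B', ∫⁻ x, σ x t :=
    lintegral_lintegral_swap hσm.aemeasurable
  have h5 : ∫⁻ t in B', ∫⁻ x, σ x t ≤ ENNReal.ofReal (C * (2 * r)) * volume B' := by
    rw [← setLIntegral_const]
    apply setLIntegral_mono' hB'm
    rintro t ⟨ht0, ht1⟩
    rw [hσt]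
    refine (htr t).trans (ENNReal.ofReal_le_ofReal (mul_le_mul_of_nonneg_left ?_ hC))
    linarith [abs_lt.mpr ht0, abs_lt.mpr ht1]
  have h6 := h1.trans (h2.le.trans ((lintegral_mono h3).trans (h4.le.trans h5)))
  rw [hvB, hvB', ← ENNReal.ofReal_mul (by positivity), ← ENNReal.ofReal_mul (by positivity),
    ENNReal.ofReal_le_ofReal_iff (by positivity)] at h6
  have h7 : (8 * C + 1) / m = (8 * C + 1) * r := by rw [hr]; ring
  rw [h7] at h6
  have : 0 < r * (r * r) := by positivity
  nlinarith

/-- Finitely many sets form a net, in measure, for all sets in a box with a given translation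
bound. -/
theorem exists_finite_net {C M : ℝ} (hC : 0 ≤ C) {ε : ℝ} (hε : 0 < ε) :
    ∃ 𝓕 : Set (Set Plane), 𝓕.Finite ∧ (∀ F ∈ 𝓕, MeasurableSet F) ∧
      ∀ E : Set Plane, MeasurableSet E → (∀ x ∈ E, ∀ i, |x i| ≤ M) → HasTranslationBound C E →
        ∃ F ∈ 𝓕, volume (E ∆ F) ≤ ENNReal.ofReal ε := by
  obtain ⟨m, hm⟩ := exists_nat_gt ((8 * C + 1) / ε)
  have hpos : (0 : ℝ) < m := lt_trans (by positivity) hm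
  have hm1 : 1 ≤ m := by exact_mod_cast hpos
  -- A sampled square with sample point in the box of size `M` has indices of modulus at most `mM +
  -- 1`.
  obtain ⟨N, hN⟩ := exists_nat_gt (m * M + 1)
  set box : Set (ℤ × ℤ) := Set.Icc (-(N : ℤ)) N ×ˢ Set.Icc (-(N : ℤ)) N
  have hbox : box.Finite := (Set.finite_Icc _ _).prod (Set.finite_Icc _ _)
  refine ⟨gridSet m '' 𝒫 box, hbox.finite_subsets.image _, ?_, ?_⟩
  · rintro F ⟨P, -, rfl⟩
    exact measurableSet_gridSet m P
  intro E hE hEM htr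
  obtain ⟨s, hs, hvol⟩ := exists_sample hC hE htr hm1
  set P : Set (ℤ × ℤ) := {p | pt m p.1 p.2 + s ∈ E}
  have hP : gridSet m P = {x | corner m x + s ∈ E} := rfl
  refine ⟨gridSet m P, ⟨P, ?_, rfl⟩, ?_⟩
  · rintro ⟨i, j⟩ hij
    have key : ∀ (l : ℤ) (y : ℝ), y ∈ Set.Ico (0 : ℝ) (1 / m) → |(l : ℝ) / m + y| ≤ M →
        l ∈ Set.Icc (-(N : ℤ)) N := by
      intro l y hy hl
      have hl' := abs_le.mp hl
      have e1 : (l : ℝ) / m * m = l := by field_simp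
      have e2 : y * m < 1 := by
        have := hy.2
        rwa [lt_div_iff₀ hpos] at this
      have e3 : 0 ≤ y * m := mul_nonneg hy.1 hpos.le
      constructor
      · have : (-(N : ℝ)) ≤ l := by nlinarith
        exact_mod_cast this
      · have : (l : ℝ) ≤ N := by nlinarith
        exact_mod_cast this
    have h0 := hEM _ hij 0
    have h1 := hEM _ hij 1
    simp only [pt, PiLp.add_apply, Matrix.cons_val_zero, Matrix.cons_val_one] at h0 h1
    exact ⟨key i _ (hs 0) h0, key j _ (hs 1) h1⟩
  · rw [hP]
    refine hvol.trans (ENNReal.ofReal_le_ofReal ?_)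
    rw [div_lt_iff₀ hε] at hm
    rw [div_le_iff₀ hpos]
    linarith

theorem dist_indicator_eq {A B : Set Plane} (hA : MeasurableSet A) (hB : MeasurableSet B)
    (hAf : volume A ≠ ⊤) (hBf : volume B ≠ ⊤) :
    dist (indicatorConstLp 1 hA hAf (1 : ℝ)) (indicatorConstLp 1 hB hBf (1 : ℝ)) =
      volume.real (A ∆ B) := by
  rw [dist_indicatorConstLp_eq_norm, norm_indicatorConstLp one_ne_zero ENNReal.one_ne_top]
  simp

/-- Compactness: sets in a box with a uniform translation bound converge in measure, along a
subsequence. -/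
theorem exists_subseq_tendsto_measure {C M : ℝ} (hC : 0 ≤ C) {S : ℕ → Set Plane}
    (hS : ∀ n, MeasurableSet (S n)) (hSM : ∀ n, ∀ x ∈ S n, ∀ i, |x i| ≤ M)
    (htr : ∀ n, HasTranslationBound C (S n)) :
    ∃ E : Set Plane, MeasurableSet E ∧ (∀ n, volume (S n ∆ E) < ⊤) ∧ ∃ φ : ℕ → ℕ, StrictMono φ ∧
      Tendsto (fun n => volume (S (φ n) ∆ E)) atTop (𝓝 0) := by
  have hbox : volume {x : Plane | x 0 ∈ Set.Icc (-M) M ∧ x 1 ∈ Set.Icc (-M) M} < ⊤ := by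
    rw [volume_coord_mem _ _ measurableSet_Icc measurableSet_Icc, Real.volume_Icc]
    exact ENNReal.mul_lt_top ENNReal.ofReal_lt_top ENNReal.ofReal_lt_top
  have hfin : ∀ n, volume (S n) ≠ ⊤ := fun n =>
    ((measure_mono (t := {x : Plane | x 0 ∈ Set.Icc (-M) M ∧ x 1 ∈ Set.Icc (-M) M})
      fun x hx => ⟨abs_le.mp (hSM n x hx 0), abs_le.mp (hSM n x hx 1)⟩).trans_lt
      hbox).ne
  set f : ℕ → Lp ℝ 1 (volume : Measure Plane) := fun n =>
    indicatorConstLp 1 (hS n) (hfin n) (1 : ℝ) with hf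
  have htb : TotallyBounded (Set.range f) := by
    rw [Metric.totallyBounded_iff]
    intro ε hε
    obtain ⟨𝓕, h𝓕, h𝓕m, hnet⟩ := exists_finite_net (M := M) hC (half_pos hε)
    classical
    -- The default 0 is never met for the net elements used: being close in measure to some `S n`,
    -- they have finite measure.
    let G : Set Plane → Lp ℝ 1 (volume : Measure Plane) := fun F =>
      if h : MeasurableSet F ∧ volume F ≠ ⊤ then indicatorConstLp 1 h.1 h.2 (1 : ℝ) else 0
    refine ⟨G '' 𝓕, h𝓕.image _, ?_⟩
    rintro _ ⟨n, rfl⟩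
    obtain ⟨F, hF, hvol⟩ := hnet (S n) (hS n) (hSM n) (htr n)
    have hFf : volume F ≠ ⊤ := by
      have hsub : F ⊆ S n ∪ (S n ∆ F) := by
        intro x hx
        by_cases h : x ∈ S n
        · exact Or.inl h
        · exact Or.inr (Or.inr ⟨hx, h⟩)
      refine ((measure_mono hsub).trans_lt ((measure_union_le _ _).trans_lt ?_)).ne
      exact ENNReal.add_lt_top.mpr ⟨(hfin n).lt_top, hvol.trans_lt ENNReal.ofReal_lt_top⟩
    simp only [Set.mem_iUnion, Metric.mem_ball]
    refine ⟨G F, ⟨F, hF, rfl⟩, ?_⟩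
    simp only [G, dif_pos (show MeasurableSet F ∧ volume F ≠ ⊤ from ⟨h𝓕m F hF, hFf⟩), hf]
    rw [dist_indicator_eq]
    have := ENNReal.toReal_le_of_le_ofReal (half_pos hε).le hvol
    exact this.trans_lt (half_lt_self hε)
  have hcomp : IsCompact (closure (Set.range f)) :=
    htb.closure.isCompact_of_isClosed isClosed_closure
  obtain ⟨F, -, φ, hφ, hlim⟩ :=
    hcomp.tendsto_subseq (x := f) fun n => subset_closure (Set.mem_range_self n)
  have hFm : Measurable F := (Lp.stronglyMeasurable F).measurable
  -- The `L¹` limit of the indicators need not be recognised as an indicator: on `S n ∆ E` the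
  -- indicator of `S n` differs from `F` by at least `1/2`, whence the factor 2 below.
  set E : Set Plane := {x | 1 / 2 < F x}
  have hEm : MeasurableSet E := measurableSet_lt measurable_const hFm
  have hbound : ∀ n, volume (S n ∆ E) ≤ 2 * edist (f n) F := by
    intro n
    rw [Lp.edist_def, eLpNorm_one_eq_lintegral_enorm, ← lintegral_const_mul' _ _ (by simp),
      ← lintegral_indicator_one ((hS n).symmDiff hEm)]
    apply lintegral_mono_ae
    filter_upwards [indicatorConstLp_coeFn (p := 1) (hs := hS n) (hμs := hfin n) (c := (1 : ℝ))]
      with x hx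
    by_cases hxE : x ∈ S n ∆ E
    · rw [Set.indicator_of_mem hxE]
      simp only [hf, Pi.sub_apply, hx, Pi.one_apply]
      have h2 : ENNReal.ofReal 2 = 2 := by simp
      have h3 : ∀ y : ℝ, 2 * ENNReal.ofReal y = ENNReal.ofReal (2 * y) := fun y => by
        rw [ENNReal.ofReal_mul (by norm_num), h2]
      rw [Real.enorm_eq_ofReal_abs, h3, ENNReal.one_le_ofReal]
      rcases hxE with ⟨h1, h2⟩ | ⟨h1, h2⟩
      · rw [Set.indicator_of_mem h1]
        have : F x ≤ 1 / 2 := not_lt.mp h2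
        rw [abs_of_nonneg (by linarith)]; linarith
      · rw [Set.indicator_of_notMem h2]
        have : 1 / 2 < F x := h1
        rw [abs_of_nonpos (by linarith)]; linarith
    · rw [Set.indicator_of_notMem hxE]
      exact zero_le
  refine ⟨E, hEm, fun n => (hbound n).trans_lt (ENNReal.mul_lt_top (by simp) (edist_lt_top _ _)),
    φ, hφ, ?_⟩
  have hlim' : Tendsto (fun n => 2 * edist (f (φ n)) F) atTop (𝓝 0) := by
    have := ENNReal.Tendsto.const_mul (a := 2) (tendsto_iff_edist_tendsto_0.mp hlim)
      (Or.inr (by simp))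
    simpa using this
  exact tendsto_of_tendsto_of_tendsto_of_le_of_le tendsto_const_nhds hlim'
    (fun n => zero_le) fun n => hbound (φ n)

/-! ### The domain and its triangles -/

theorem mem_Omega_iff {x : Plane} : x ∈ Omega ↔ |x 1| ≤ 1 ∧ |x 0 + x 1| ≤ 4 := by
  constructor
  · have hsub : Omega ⊆ {x : Plane | (-1 ≤ x 1 ∧ x 1 ≤ 1) ∧ (-4 ≤ x 0 + x 1 ∧ x 0 + x 1 ≤ 4)} := by
      apply convexHull_min
      · rintro x (rfl | rfl | rfl | rfl) <;> norm_num
      · intro x hx y hy s t hs ht hst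
        simp only [Set.mem_ofPred_eq, PiLp.add_apply, PiLp.smul_apply, smul_eq_mul] at *
        refine ⟨⟨?_, ?_⟩, ?_, ?_⟩ <;> nlinarith
    intro hx
    exact ⟨abs_le.mpr (hsub hx).1, abs_le.mpr (hsub hx).2⟩
  · rintro ⟨h1, h2⟩
    rw [abs_le] at h1 h2
    -- `α` is the relative position along the horizontal sides and `β` the relative height; the
    -- point is their bilinear interpolation of the vertices.
    set α : ℝ := (4 + (x 0 + x 1)) / 8 with hα
    set β : ℝ := (1 + x 1) / 2 with hβ
    have hconv : Convex ℝ Omega := convex_convexHull ℝ _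
    have hv : ∀ y ∈ ({!₂[-4 - 1, 1], !₂[4 - 1, 1], !₂[4 + 1, -1], !₂[1 - 4, -1]} : Set Plane),
        y ∈ Omega := fun y hy => subset_convexHull ℝ _ hy
    have htop := hconv (hv !₂[-4 - 1, 1] (by simp)) (hv !₂[4 - 1, 1] (by simp))
      (show 0 ≤ 1 - α by linarith) (show 0 ≤ α by linarith) (by ring)
    have hbot := hconv (hv !₂[1 - 4, -1] (by simp)) (hv !₂[4 + 1, -1] (by simp))
      (show 0 ≤ 1 - α by linarith) (show 0 ≤ α by linarith) (by ring)
    convert hconv htop hbot (show 0 ≤ β by linarith) (show 0 ≤ 1 - β by linarith) (by ring)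
      using 1
    ext i
    fin_cases i
    · simp [hα, hβ]; ring
    · simp [hβ]; ring

theorem convex_Omega : Convex ℝ Omega := convex_convexHull ℝ _

theorem pt_mem_Omega_iff {n : ℕ} (hn : 1 ≤ n) {i j : ℤ} :
    pt n i j ∈ Omega ↔ |j| ≤ (n : ℤ) ∧ |i + j| ≤ 4 * (n : ℤ) := by
  have hpos : (0 : ℝ) < n := by exact_mod_cast hn
  rw [mem_Omega_iff]
  simp only [pt, Matrix.cons_val_zero, Matrix.cons_val_one]
  rw [← add_div, abs_div, abs_div, abs_of_pos hpos, div_le_one hpos, div_le_iff₀ hpos]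
  norm_cast

theorem mem_bulkIndex_iff {n : ℕ} (hn : 1 ≤ n) {i j : ℤ} :
    (i, j) ∈ bulkIndex n ↔ |j| < (n : ℤ) ∧ |i + j| ≤ 4 * (n : ℤ) := by
  simp only [bulkIndex, gridIndex, Set.mem_ofPred_eq, pt_mem_Omega_iff hn]
  constructor
  · rintro ⟨⟨-, h⟩, h'⟩; exact ⟨h', h⟩
  · rintro ⟨h', h⟩; exact ⟨⟨h'.le, h⟩, h'⟩

theorem triPlus_subset_Omega {n : ℕ} (hn : 1 ≤ n) {i j : ℤ} (h1 : -(n : ℤ) ≤ j)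
    (h2 : j + 1 ≤ n) (h3 : -(4 * (n : ℤ)) ≤ i + j) (h4 : i + j + 1 ≤ 4 * n) :
    triPlus n i j ⊆ Omega := by
  apply convexHull_min _ convex_Omega
  rintro x (rfl | rfl | rfl) <;> rw [pt_mem_Omega_iff hn, abs_le, abs_le] <;> omega

theorem triMinus_subset_Omega {n : ℕ} (hn : 1 ≤ n) {i j : ℤ} (h1 : -(n : ℤ) ≤ j - 1)
    (h2 : j ≤ n) (h3 : -(4 * (n : ℤ)) ≤ i + j - 1) (h4 : i + j ≤ 4 * n) :
    triMinus n i j ⊆ Omega := by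
  apply convexHull_min _ convex_Omega
  rintro x (rfl | rfl | rfl) <;> rw [pt_mem_Omega_iff hn, abs_le, abs_le] <;> omega

theorem mem_convexHull_triple {p q r x : Plane} {α β γ : ℝ} (hα : 0 ≤ α) (hβ : 0 ≤ β)
    (hγ : 0 ≤ γ) (hsum : α + β + γ = 1) (hx : x = α • p + β • q + γ • r) :
    x ∈ convexHull ℝ {p, q, r} := by
  have h := (convex_convexHull ℝ ({p, q, r} : Set Plane)).sum_mem (t := Finset.univ)
    (w := ![α, β, γ]) (z := ![p, q, r])
    (by intro i _; fin_cases i <;> simpa)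
    (by simp [Fin.sum_univ_three, hsum])
    (by intro i _; apply subset_convexHull; fin_cases i <;> simp)
  rw [hx]
  simpa [Fin.sum_univ_three] using h

theorem mem_triPlus {n : ℕ} (hn : 1 ≤ n) {i j : ℤ} {x : Plane} (h0 : (i : ℝ) ≤ n * x 0)
    (h1 : (j : ℝ) ≤ n * x 1) (h2 : n * x 0 + n * x 1 ≤ i + j + 1) : x ∈ triPlus n i j := by
  have hpos : (0 : ℝ) < n := by exact_mod_cast hn
  apply mem_convexHull_triple (α := 1 - (n * x 0 - i) - (n * x 1 - j)) (β := n * x 1 - j)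
    (γ := n * x 0 - i) (by linarith) (by linarith) (by linarith) (by ring)
  ext l
  fin_cases l <;> simp [pt] <;> field_simp <;> ring

theorem mem_triMinus {n : ℕ} (hn : 1 ≤ n) {i j : ℤ} {x : Plane} (h0 : n * x 0 ≤ i)
    (h1 : n * x 1 ≤ j) (h2 : (i : ℝ) + j - 1 ≤ n * x 0 + n * x 1) : x ∈ triMinus n i j := by
  have hpos : (0 : ℝ) < n := by exact_mod_cast hn
  apply mem_convexHull_triple (α := 1 - (i - n * x 0) - (j - n * x 1)) (β := i - n * x 0)
    (γ := j - n * x 1) (by linarith) (by linarith) (by linarith) (by ring)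
  ext l
  fin_cases l <;> simp [pt] <;> field_simp <;> ring

/-! ### Difference quotients -/

/-- The horizontal difference quotient to the right of `(i/n, j/n)`. -/
def hdiff (n : ℕ) (u : Plane → Plane) (i j : ℤ) : Plane :=
  (n : ℝ) • (u (pt n (i + 1) j) - u (pt n i j))

/-- The vertical difference quotient above `(i/n, j/n)`. -/
def vdiff (n : ℕ) (u : Plane → Plane) (i j : ℤ) : Plane :=
  (n : ℝ) • (u (pt n i (j + 1)) - u (pt n i j))

theorem stencil_zero (n : ℕ) (u : Plane → Plane) (i j : ℤ) :
    stencil n u (i, j) 0 = hdiff n u i j := rfl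

theorem stencil_one (n : ℕ) (u : Plane → Plane) (i j : ℤ) :
    stencil n u (i + 1, j) 1 = hdiff n u i j := by
  simp [stencil, hdiff]

theorem stencil_two (n : ℕ) (u : Plane → Plane) (i j : ℤ) :
    stencil n u (i, j) 2 = vdiff n u i j := rfl

theorem stencil_three (n : ℕ) (u : Plane → Plane) (i j : ℤ) :
    stencil n u (i, j + 1) 3 = vdiff n u i j := by
  simp [stencil, vdiff]

theorem hdiff_add_vdiff (n : ℕ) (u : Plane → Plane) (i j : ℤ) :
    hdiff n u i j + vdiff n u (i + 1) j = vdiff n u i j + hdiff n u i (j + 1) := by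
  simp only [hdiff, vdiff, ← smul_add]
  congr 1
  abel

theorem det2_smul (c d : ℝ) (v w : Plane) : det2 (c • v) (d • w) = c * d * det2 v w := by
  simp [det2]; ring

theorem grad_of_eventuallyEq {u : Plane → Plane} {A : Plane →ᵃ[ℝ] Plane} {x : Plane}
    (h : u =ᶠ[𝓝 x] A) : grad u x = columns (A.linear (EuclideanSpace.single 0 1))
      (A.linear (EuclideanSpace.single 1 1)) := by
  have hA : HasFDerivAt A (LinearMap.toContinuousLinearMap A.linear) x := by
    have h1 := (LinearMap.toContinuousLinearMap A.linear).hasFDerivAt (x := x)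
    have h2 : (A : Plane → Plane) = fun y => LinearMap.toContinuousLinearMap A.linear y + A 0 := by
      rw [AffineMap.decomp A]; ext y; simp
    rw [h2]
    exact h1.add_const _
  have hd : fderiv ℝ u x = LinearMap.toContinuousLinearMap A.linear :=
    (hA.congr_of_eventuallyEq h).fderiv
  ext i j
  fin_cases i <;> fin_cases j <;> simp [grad, columns, hd]

theorem pt_sub_hor {n : ℕ} (hn : 1 ≤ n) (i j : ℤ) :
    (EuclideanSpace.single 0 1 : Plane) = (n : ℝ) • (pt n (i + 1) j - pt n i j) := by
  have hpos : (n : ℝ) ≠ 0 := by positivity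
  ext l
  fin_cases l <;> simp [pt] <;> field_simp <;> ring

theorem pt_sub_ver {n : ℕ} (hn : 1 ≤ n) (i j : ℤ) :
    (EuclideanSpace.single 1 1 : Plane) = (n : ℝ) • (pt n i (j + 1) - pt n i j) := by
  have hpos : (n : ℝ) ≠ 0 := by positivity
  ext l
  fin_cases l <;> simp [pt] <;> field_simp <;> ring

theorem linear_hor {n : ℕ} (hn : 1 ≤ n) {u : Plane → Plane} {A : Plane →ᵃ[ℝ] Plane} {i j : ℤ}
    (h0 : u (pt n i j) = A (pt n i j)) (h1 : u (pt n (i + 1) j) = A (pt n (i + 1) j)) :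
    A.linear (EuclideanSpace.single 0 1) = hdiff n u i j := by
  rw [pt_sub_hor hn i j, map_smul, ← vsub_eq_sub, AffineMap.linearMap_vsub, vsub_eq_sub, hdiff,
    h0, h1]

theorem linear_ver {n : ℕ} (hn : 1 ≤ n) {u : Plane → Plane} {A : Plane →ᵃ[ℝ] Plane} {i j : ℤ}
    (h0 : u (pt n i j) = A (pt n i j)) (h1 : u (pt n i (j + 1)) = A (pt n i (j + 1))) :
    A.linear (EuclideanSpace.single 1 1) = vdiff n u i j := by
  rw [pt_sub_ver hn i j, map_smul, ← vsub_eq_sub, AffineMap.linearMap_vsub, vsub_eq_sub, vdiff,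
    h0, h1]

theorem grad_triPlus {n : ℕ} (hn : 1 ≤ n) {u : Plane → Plane} (hu : IsPiecewiseAffine n u)
    {i j : ℤ} (hsub : triPlus n i j ⊆ Omega) {x : Plane} (h0 : (i : ℝ) < n * x 0)
    (h1 : (j : ℝ) < n * x 1) (h2 : n * x 0 + n * x 1 < i + j + 1) :
    grad u x = columns (hdiff n u i j) (vdiff n u i j) := by
  obtain ⟨A, hA⟩ := hu.1 i j hsub
  have hc : ∀ l : Fin 2, Continuous fun y : Plane => (n : ℝ) * y l := fun l => by fun_prop
  have hev : u =ᶠ[𝓝 x] A := by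
    filter_upwards [(hc 0).continuousAt.eventually_const_lt h0,
      (hc 1).continuousAt.eventually_const_lt h1,
      ((hc 0).add (hc 1)).continuousAt.eventually_lt_const h2] with y hy0 hy1 hy2
    exact hA (mem_triPlus hn hy0.le hy1.le hy2.le)
  have hp : ∀ y ∈ ({pt n i j, pt n i (j + 1), pt n (i + 1) j} : Set Plane), u y = A y :=
    fun y hy => hA (subset_convexHull ℝ _ hy)
  rw [grad_of_eventuallyEq hev, linear_hor (i := i) (j := j) hn (hp _ (by simp)) (hp _ (by simp)),
    linear_ver (i := i) (j := j) hn (hp _ (by simp)) (hp _ (by simp))]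

/-- The lower-left triangle at `(i+1, j+1)` is the upper half of the square `(i, j)`; its legs are
the top and the right side of that square. The strict inequalities put `x` in its interior, where
`u` is locally affine. -/
theorem grad_triMinus {n : ℕ} (hn : 1 ≤ n) {u : Plane → Plane} (hu : IsPiecewiseAffine n u)
    {i j : ℤ} (hsub : triMinus n (i + 1) (j + 1) ⊆ Omega) {x : Plane} (h0 : n * x 0 < i + 1)
    (h1 : n * x 1 < j + 1) (h2 : (i : ℝ) + j + 1 < n * x 0 + n * x 1) :
    grad u x = columns (hdiff n u i (j + 1)) (vdiff n u (i + 1) j) := by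
  obtain ⟨A, hA⟩ := hu.2 _ _ hsub
  have hc : ∀ l : Fin 2, Continuous fun y : Plane => (n : ℝ) * y l := fun l => by fun_prop
  have hev : u =ᶠ[𝓝 x] A := by
    filter_upwards [(hc 0).continuousAt.eventually_lt_const h0,
      (hc 1).continuousAt.eventually_lt_const h1,
      ((hc 0).add (hc 1)).continuousAt.eventually_const_lt h2] with y hy0 hy1 hy2
    apply hA (mem_triMinus hn _ _ _) <;> push_cast
    · exact hy0.le
    · exact hy1.le
    · have : (i : ℝ) + j + 1 < n * y 0 + n * y 1 := hy2
      linarith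
  have hp : ∀ y ∈ ({pt n (i + 1) (j + 1), pt n i (j + 1), pt n (i + 1) j} : Set Plane),
      u y = A y := by
    intro y hy
    apply hA (subset_convexHull ℝ _ _)
    simpa using hy
  rw [grad_of_eventuallyEq hev, linear_hor (i := i) (j := j + 1) hn (hp _ (by simp)) (hp _ (by simp)),
    linear_ver (i := i + 1) (j := j) hn (hp _ (by simp)) (hp _ (by simp))]

/-- Almost every point of the domain lies in the interior of a grid triangle in the domain. -/
theorem ae_generic (n : ℕ) (hn : 1 ≤ n) : ∀ᵐ x : Plane,
    (n * x 0 ≠ ⌊n * x 0⌋) ∧ (n * x 1 ≠ ⌊n * x 1⌋) ∧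
      n * x 0 + n * x 1 ≠ ⌊n * x 0⌋ + ⌊n * x 1⌋ + 1 := by
  have hpos : (n : ℝ) ≠ 0 := by positivity
  -- The integer level sets of a nonzero linear functional are countably many null lines.
  have key : ∀ f : Plane →ₗ[ℝ] ℝ, (∃ y, f y ≠ 0) → ∀ᵐ x, ∀ l : ℤ, f x ≠ l := by
    rintro f ⟨y, hy⟩
    rw [ae_all_iff]
    intro l
    have h := Measure.addHaar_affineSubspace (volume : Measure Plane)
      ((AffineSubspace.mk' (l : ℝ) (⊥ : Submodule ℝ ℝ)).comap f.toAffineMap) ?_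
    · rw [ae_iff]
      convert h using 2
      ext x
      simp [AffineSubspace.mem_mk', sub_eq_zero]
    · intro htop
      have h1 : ((((l : ℝ) + 1) / f y) • y) ∈
          (AffineSubspace.mk' (l : ℝ) (⊥ : Submodule ℝ ℝ)).comap f.toAffineMap := by
        rw [htop]; exact AffineSubspace.mem_top _ _ _
      simp [AffineSubspace.mem_mk', hy] at h1
  have e0 := key ((n : ℝ) • (EuclideanSpace.proj (𝕜 := ℝ) (0 : Fin 2)).toLinearMap)
    ⟨EuclideanSpace.single 0 1, by simpa using hpos⟩
  have e1 := key ((n : ℝ) • (EuclideanSpace.proj (𝕜 := ℝ) (1 : Fin 2)).toLinearMap)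
    ⟨EuclideanSpace.single 1 1, by simpa using hpos⟩
  have e2 := key ((n : ℝ) • (EuclideanSpace.proj (𝕜 := ℝ) (0 : Fin 2)).toLinearMap +
      (n : ℝ) • (EuclideanSpace.proj (𝕜 := ℝ) (1 : Fin 2)).toLinearMap)
    ⟨EuclideanSpace.single 1 1, by simpa using hpos⟩
  filter_upwards [e0, e1, e2] with x h0 h1 h2
  refine ⟨by simpa using h0 ⌊n * x 0⌋, by simpa using h1 ⌊n * x 1⌋, ?_⟩
  have := h2 (⌊n * x 0⌋ + ⌊n * x 1⌋ + 1)
  push_cast at this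
  simpa using this

/-- The gradient at a generic point of the square `(i, j)` is one of two matrices of difference
quotients, according to the triangle. -/
theorem grad_cases {n : ℕ} (hn : 1 ≤ n) {u : Plane → Plane} (hu : IsPiecewiseAffine n u)
    {x : Plane} (hx : x ∈ Omega) {i j : ℤ} (hi : ⌊n * x 0⌋ = i) (hj : ⌊n * x 1⌋ = j)
    (hgen : (n * x 0 ≠ ⌊n * x 0⌋) ∧ (n * x 1 ≠ ⌊n * x 1⌋) ∧
      n * x 0 + n * x 1 ≠ ⌊n * x 0⌋ + ⌊n * x 1⌋ + 1) :
    (grad u x = columns (hdiff n u i j) (vdiff n u i j) ∧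
      -(n : ℤ) ≤ j ∧ j + 1 ≤ n ∧ -(4 * (n : ℤ)) ≤ i + j ∧ i + j + 1 ≤ 4 * n) ∨
    (grad u x = columns (hdiff n u i (j + 1)) (vdiff n u (i + 1) j) ∧
      -(n : ℤ) ≤ j ∧ j + 1 ≤ n ∧ -(4 * (n : ℤ)) ≤ i + j + 1 ∧ i + j + 2 ≤ 4 * n) := by
  have hpos : (0 : ℝ) < n := by exact_mod_cast hn
  obtain ⟨g0, g1, g2⟩ := hgen
  rw [hi] at g0 g2
  rw [hj] at g1 g2
  rw [Int.floor_eq_iff] at hi hj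
  have i0 : (i : ℝ) < n * x 0 := lt_of_le_of_ne hi.1 g0.symm
  have j0 : (j : ℝ) < n * x 1 := lt_of_le_of_ne hj.1 g1.symm
  obtain ⟨o1, o2⟩ := mem_Omega_iff.mp hx
  rw [abs_le] at o1 o2
  have q1 : -(n : ℝ) ≤ n * x 1 := by nlinarith
  have q2 : n * x 1 ≤ (n : ℝ) := by nlinarith
  have q3 : -(4 * (n : ℝ)) ≤ n * x 0 + n * x 1 := by nlinarith
  have q4 : n * x 0 + n * x 1 ≤ 4 * (n : ℝ) := by nlinarith
  have r1 : -(n : ℤ) < j + 1 := by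
    have : (-(n : ℝ)) < j + 1 := by linarith
    exact_mod_cast this
  have r2 : j < (n : ℤ) := by
    have : (j : ℝ) < n := by linarith
    exact_mod_cast this
  -- The sides of `Ω` lie on grid lines, so a triangle with an interior point in `Ω` lies entirely
  -- in `Ω`; on indices, strict inequalities between integers gain one.
  rcases lt_or_gt_of_ne g2 with h | h
  · left
    have r3 : -(4 * (n : ℤ)) < i + j + 1 := by
      have : -(4 * (n : ℝ)) < i + j + 1 := by linarith
      exact_mod_cast this
    have r4 : i + j < 4 * (n : ℤ) := by
      have : (i : ℝ) + j < 4 * n := by linarith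
      exact_mod_cast this
    refine ⟨grad_triPlus hn hu (triPlus_subset_Omega hn ?_ ?_ ?_ ?_) i0 j0 h, ?_, ?_, ?_, ?_⟩ <;>
      omega
  · right
    have r3 : -(4 * (n : ℤ)) < i + j + 2 := by
      have : -(4 * (n : ℝ)) < i + j + 2 := by linarith
      exact_mod_cast this
    have r4 : i + j + 1 < 4 * (n : ℤ) := by
      have : (i : ℝ) + j + 1 < 4 * n := by linarith
      exact_mod_cast this
    refine ⟨grad_triMinus hn hu (triMinus_subset_Omega hn ?_ ?_ ?_ ?_) hi.2 hj.2 h,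
      ?_, ?_, ?_, ?_⟩ <;> omega

/-! ### The local energy and the phases -/

/-- The local energy density at grid points, extended by zero. -/
def localEnergy (h : Quad → ℝ) (n : ℕ) (u : Plane → Plane) (p : ℤ × ℤ) : ℝ :=
  (bulkIndex n).indicator (fun p => h (stencil n u p)) p

/-- The sum of the local energies at the four corners of a grid square. -/
def cornerEnergy (h : Quad → ℝ) (n : ℕ) (u : Plane → Plane) (p : ℤ × ℤ) : ℝ :=
  localEnergy h n u p + localEnergy h n u (p + (1, 0)) + localEnergy h n u (p + (0, 1))
    + localEnergy h n u (p + (1, 1))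

section

variable {h : Quad → ℝ} {n : ℕ} {u : Plane → Plane}

theorem localEnergy_of_mem {p : ℤ × ℤ} (hp : p ∈ bulkIndex n) :
    localEnergy h n u p = h (stencil n u p) := Set.indicator_of_mem hp _

theorem localEnergy_nonneg (hh : ∀ G, 0 ≤ h G) (p : ℤ × ℤ) : 0 ≤ localEnergy h n u p :=
  Set.indicator_nonneg (fun _ _ => hh _) p

theorem cornerEnergy_nonneg (hh : ∀ G, 0 ≤ h G) (p : ℤ × ℤ) : 0 ≤ cornerEnergy h n u p := by
  have := fun p => localEnergy_nonneg (n := n) (u := u) hh p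
  exact add_nonneg (add_nonneg (add_nonneg (this _) (this _)) (this _)) (this _)

theorem localEnergy_le_cornerEnergy (hh : ∀ G, 0 ≤ h G) (i j : ℤ) :
    localEnergy h n u (i, j) ≤ cornerEnergy h n u (i, j) ∧
    localEnergy h n u (i + 1, j) ≤ cornerEnergy h n u (i, j) ∧
    localEnergy h n u (i, j + 1) ≤ cornerEnergy h n u (i, j) ∧
    localEnergy h n u (i + 1, j + 1) ≤ cornerEnergy h n u (i, j) := by
  have e := fun p => localEnergy_nonneg (n := n) (u := u) hh p
  have h1 := e (i, j)
  have h2 := e (i + 1, j)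
  have h3 := e (i, j + 1)
  have h4 := e (i + 1, j + 1)
  simp only [cornerEnergy, Prod.mk_add_mk, add_zero]
  refine ⟨?_, ?_, ?_, ?_⟩ <;> linarith

end

theorem norm_sq_add_sub_le {x y z : Plane} {B : ℝ} (hx : ‖x‖ ^ 2 ≤ B) (hy : ‖y‖ ^ 2 ≤ B)
    (hz : ‖z‖ ^ 2 ≤ B) : ‖x + y - z‖ ^ 2 ≤ 9 * B := by
  have h1 : ‖x + y - z‖ ≤ ‖x‖ + ‖y‖ + ‖z‖ :=
    (norm_sub_le _ _).trans (add_le_add_left (norm_add_le _ _) _)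
  have h2 := pow_le_pow_left₀ (norm_nonneg _) h1 2
  nlinarith [sq_nonneg (‖x‖ - ‖y‖), sq_nonneg (‖y‖ - ‖z‖), sq_nonneg (‖x‖ - ‖z‖)]

theorem quad_comp_norm_sq_le (G : Quad) (l : Fin 4) : ‖G l‖ ^ 2 ≤ ‖G‖ ^ 2 :=
  pow_le_pow_left₀ (norm_nonneg _) (PiLp.norm_apply_le G l) 2

theorem act_sub (M : Matrix (Fin 2) (Fin 2) ℝ) (x y : Plane) :
    act M x - act M y = act M (x - y) := by
  rw [act, act, act, WithLp.ofLp_sub, Matrix.mulVec_sub, WithLp.toLp_sub]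

theorem act_smul (M : Matrix (Fin 2) (Fin 2) ℝ) (c : ℝ) (x : Plane) :
    c • act M x = act M (c • x) := by
  rw [act, act, WithLp.ofLp_smul, Matrix.mulVec_smul, WithLp.toLp_smul]

/-! ### Boundary data, orientation and bounds for difference quotients -/

section

variable {a b lam : ℝ} {n : ℕ} {u : Plane → Plane}

/-- Near the lateral sides a grid square may have a corner outside `Ω` that carries no stencil;
there the boundary data supply the missing vertical bond. -/
theorem vdiff_eq_of_left (hn : 1 ≤ n) (hu : IsAdmissible a b lam n u) {i j : ℤ}
    (h : i + j + 1 ≤ -4 * (n : ℤ)) :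
    vdiff n u i j = act (F a b lam) (EuclideanSpace.single 1 1) := by
  rw [vdiff, hu.left_bc i j (by omega), hu.left_bc i (j + 1) (by omega), act_sub, act_smul,
    ← pt_sub_ver hn]

theorem vdiff_eq_of_right (hn : 1 ≤ n) (hu : IsAdmissible a b lam n u) {i j : ℤ}
    (h : 4 * (n : ℤ) ≤ i + j) :
    vdiff n u i j = act (F a b lam) (EuclideanSpace.single 1 1) := by
  obtain ⟨c, hc⟩ := hu.right_bc
  rw [vdiff, hc i j h, hc i (j + 1) (by omega), add_sub_add_right_eq_sub, act_sub, act_smul,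
    ← pt_sub_ver hn]

theorem det2_diff_pos_of_triPlus (hn : 1 ≤ n) (hu : IsAdmissible a b lam n u) {i j : ℤ}
    (h : triPlus n i j ⊆ Omega) : 0 < det2 (hdiff n u i j) (vdiff n u i j) := by
  have hpos : (0 : ℝ) < n := by exact_mod_cast hn
  rw [hdiff, vdiff, det2_smul]
  exact mul_pos (mul_pos hpos hpos) (hu.orient_plus i j h)

theorem det2_diff_pos_of_triMinus (hn : 1 ≤ n) (hu : IsAdmissible a b lam n u) {i j : ℤ}
    (h : triMinus n (i + 1) (j + 1) ⊆ Omega) :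
    0 < det2 (hdiff n u i (j + 1)) (vdiff n u (i + 1) j) := by
  have hpos : (0 : ℝ) < n := by exact_mod_cast hn
  have h1 := hu.orient_minus _ _ h
  rw [add_sub_cancel_right, add_sub_cancel_right] at h1
  rw [hdiff, vdiff, ← neg_sub (u (pt n i (j + 1))), ← neg_sub (u (pt n (i + 1) j)), smul_neg,
    smul_neg, ← neg_smul, ← neg_smul, det2_smul]
  exact mul_pos (by nlinarith) h1

/-- The gradient is bounded by the energy at the corners of the grid square. In the top and bottom
rows this uses that the four difference quotients around a square add up to zero. -/
theorem exists_norm_sq_diff_le {h : Quad → ℝ} (hh : ∀ G, 0 ≤ h G)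
    (hK : ∃ K : ℝ, 0 ≤ K ∧ ∀ G, ‖G‖ ^ 2 ≤ K * (1 + h G)) (a b lam : ℝ) :
    ∃ K : ℝ, 0 ≤ K ∧ ∀ n : ℕ, 1 ≤ n → ∀ u : Plane → Plane, IsAdmissible a b lam n u →
      ∀ i j : ℤ, -(n : ℤ) ≤ j → j + 1 ≤ n →
      (-(4 * (n : ℤ)) ≤ i + j → i + j + 1 ≤ 4 * n →
        ‖hdiff n u i j‖ ^ 2 + ‖vdiff n u i j‖ ^ 2 ≤ K * (1 + cornerEnergy h n u (i, j))) ∧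
      (-(4 * (n : ℤ)) ≤ i + j + 1 → i + j + 2 ≤ 4 * n →
        ‖hdiff n u i (j + 1)‖ ^ 2 + ‖vdiff n u (i + 1) j‖ ^ 2 ≤
          K * (1 + cornerEnergy h n u (i, j))) := by
  obtain ⟨K, hK0, hK⟩ := hK
  set f := ‖act (F a b lam) (EuclideanSpace.single 1 1)‖ ^ 2
  have hf : 0 ≤ f := by positivity
  -- In the worst case one bond is reconstructed from three others, at the cost of a factor 9, and
  -- the other bond costs 1. The summand `f` covers bonds fixed by the boundary data.
  refine ⟨10 * (K + f), by positivity, fun n hn u hu i j hj1 hj2 => ?_⟩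
  set N := cornerEnergy h n u (i, j) with hN
  have hN0 : 0 ≤ N := cornerEnergy_nonneg hh _
  obtain ⟨c1, c2, c3, c4⟩ := localEnergy_le_cornerEnergy (n := n) (u := u) hh i j
  rw [← hN] at c1 c2 c3 c4
  set B := (K + f) * (1 + N) with hB
  have hB0 : 0 ≤ B := by positivity
  have hfB : f ≤ B := by
    have : 0 ≤ (K + f) * N := by positivity
    have : B = K + f + (K + f) * N := by rw [hB]; ring
    linarith
  have hcomp : ∀ (q : ℤ × ℤ) (l : Fin 4), q ∈ bulkIndex n → localEnergy h n u q ≤ N →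
      ‖stencil n u q l‖ ^ 2 ≤ B := by
    intro q l hq hle
    rw [localEnergy_of_mem hq] at hle
    calc ‖stencil n u q l‖ ^ 2 ≤ ‖stencil n u q‖ ^ 2 := quad_comp_norm_sq_le _ _
      _ ≤ K * (1 + h (stencil n u q)) := hK _
      _ ≤ K * (1 + N) := by gcongr
      _ ≤ B := by
        have : 0 ≤ f * (1 + N) := by positivity
        rw [hB]; linarith
  have hsq := hdiff_add_vdiff n u i j
  rw [mul_assoc, ← hB]
  constructor
  · intro h1 h2
    by_cases hrow : -(n : ℤ) < j
    · have hq : (i, j) ∈ bulkIndex n := by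
        rw [mem_bulkIndex_iff hn, abs_lt, abs_le]; omega
      have e1 := hcomp _ 0 hq c1
      have e2 := hcomp _ 2 hq c1
      rw [stencil_zero] at e1
      rw [stencil_two] at e2
      linarith
    -- In the bottom row `j = -n` the lower side of the square belongs to no stencil of the energy;
    -- it is recovered from the other three sides.
    · have hq : (i, j + 1) ∈ bulkIndex n := by
        rw [mem_bulkIndex_iff hn, abs_lt, abs_le]; omega
      have e1 := hcomp _ 0 hq c3
      have e2 := hcomp _ 3 hq c3
      rw [stencil_zero] at e1
      rw [stencil_three] at e2
      have e3 : ‖vdiff n u (i + 1) j‖ ^ 2 ≤ B := by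
        by_cases hcol : i + j + 2 ≤ 4 * n
        · have hq' : (i + 1, j + 1) ∈ bulkIndex n := by
            rw [mem_bulkIndex_iff hn, abs_lt, abs_le]; omega
          have := hcomp _ 3 hq' c4
          rwa [stencil_three] at this
        · rw [vdiff_eq_of_right hn hu (by omega)]
          exact hfB
      have e4 : hdiff n u i j = vdiff n u i j + hdiff n u i (j + 1) - vdiff n u (i + 1) j := by
        rw [← hsq, add_sub_cancel_right]
      have := norm_sq_add_sub_le e2 e1 e3
      rw [← e4] at this
      linarith
  · intro h1 h2
    by_cases hrow : j + 1 < n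
    · have hq : (i + 1, j + 1) ∈ bulkIndex n := by
        rw [mem_bulkIndex_iff hn, abs_lt, abs_le]; omega
      have e1 := hcomp _ 1 hq c4
      have e2 := hcomp _ 3 hq c4
      rw [stencil_one] at e1
      rw [stencil_three] at e2
      linarith
    · have hq : (i + 1, j) ∈ bulkIndex n := by
        rw [mem_bulkIndex_iff hn, abs_lt, abs_le]; omega
      have e1 := hcomp _ 1 hq c2
      have e2 := hcomp _ 2 hq c2
      rw [stencil_one] at e1
      rw [stencil_two] at e2
      have e3 : ‖vdiff n u i j‖ ^ 2 ≤ B := by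
        by_cases hcol : -(4 * (n : ℤ)) ≤ i + j
        · have hq' : (i, j) ∈ bulkIndex n := by
            rw [mem_bulkIndex_iff hn, abs_lt, abs_le]; omega
          have := hcomp _ 2 hq' c1
          rwa [stencil_two] at this
        · rw [vdiff_eq_of_left hn hu (by omega)]
          exact hfB
      have e4 : hdiff n u i (j + 1) = hdiff n u i j + vdiff n u (i + 1) j - vdiff n u i j := by
        rw [hsq, add_sub_cancel_left]
      have := norm_sq_add_sub_le e1 e2 e3
      rw [← e4] at this
      linarith

end

/-! ### The boundary strip -/

/-- The grid points of `Ω`, or next to `Ω`, near the boundary. -/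
def strip (n : ℕ) : Finset (ℤ × ℤ) :=
  ((Finset.Icc (-4 * (n : ℤ) - 2) (4 * n + 2) ×ˢ {-(n : ℤ), -(n : ℤ) + 1, (n : ℤ) - 1, (n : ℤ)}) ∪
    ((Finset.Icc (-4 * (n : ℤ) - 2) (-4 * n + 2) ∪ Finset.Icc (4 * (n : ℤ) - 2) (4 * n + 2)) ×ˢ
      Finset.Icc (-(n : ℤ)) n)).image fun q => (q.1 - q.2, q.2)

theorem mem_strip_iff {n : ℕ} {i j : ℤ} : (i, j) ∈ strip n ↔
    (-4 * (n : ℤ) - 2 ≤ i + j ∧ i + j ≤ 4 * n + 2 ∧ (j = -n ∨ j = -n + 1 ∨ j = n - 1 ∨ j = n)) ∨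
    ((-4 * (n : ℤ) - 2 ≤ i + j ∧ i + j ≤ -4 * n + 2 ∨
      4 * (n : ℤ) - 2 ≤ i + j ∧ i + j ≤ 4 * n + 2) ∧ -(n : ℤ) ≤ j ∧ j ≤ n) := by
  simp only [strip, Finset.mem_image, Finset.mem_union, Finset.mem_product, Finset.mem_Icc,
    Finset.mem_insert, Finset.mem_singleton, Prod.mk.injEq, Prod.exists]
  constructor
  · rintro ⟨s, l, hs, h1, rfl⟩
    obtain rfl : s = i + l := by omega
    omega
  · intro hs
    exact ⟨i + j, j, by omega, by omega, rfl⟩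

/-- The count is at most `52n + 30 ≤ 82n`. Being linear in `n`, it gives the strip area `O(1/n)` and
interface length `O(1)`. -/
theorem card_strip_le {n : ℕ} (hn : 1 ≤ n) : ((strip n).card : ℝ) ≤ 82 * n := by
  have h1 : (strip n).card ≤ (8 * n + 5) * 4 + (5 + 5) * (2 * n + 1) := by
    refine Finset.card_image_le.trans ((Finset.card_union_le _ _).trans (add_le_add ?_ ?_))
    · rw [Finset.card_product, Int.card_Icc]
      exact mul_le_mul (by omega) Finset.card_le_four (by omega) (by omega)
    · rw [Finset.card_product, Int.card_Icc]
      refine mul_le_mul ((Finset.card_union_le _ _).trans ?_) (by omega) (by omega) (by omega)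
      rw [Int.card_Icc, Int.card_Icc]
      omega
  have h2 : (strip n).card ≤ 82 * n := by omega
  exact_mod_cast h2

/-- Away from the strip, membership of the domain and of the index set agree. -/
theorem mem_Omega_iff_of_notMem_strip {n : ℕ} (hn : 1 ≤ n) {x : Plane}
    (hx : cell n x ∉ strip n) : x ∈ Omega ↔ cell n x ∈ bulkIndex n := by
  have hpos : (0 : ℝ) < n := by exact_mod_cast hn
  obtain ⟨i, hi⟩ : ∃ i, ⌊n * x 0⌋ = i := ⟨_, rfl⟩
  obtain ⟨j, hj⟩ : ∃ j, ⌊n * x 1⌋ = j := ⟨_, rfl⟩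
  have hcell : cell n x = (i, j) := by rw [cell, hi, hj]
  rw [hcell] at hx ⊢
  rw [mem_strip_iff] at hx
  rw [mem_bulkIndex_iff hn, mem_Omega_iff, abs_lt, abs_le, abs_le, abs_le]
  rw [Int.floor_eq_iff] at hi hj
  constructor
  · rintro ⟨o1, o2⟩
    have q1 : -(n : ℝ) ≤ n * x 1 := by nlinarith
    have q2 : n * x 1 ≤ (n : ℝ) := by nlinarith
    have q3 : -(4 * (n : ℝ)) ≤ n * x 0 + n * x 1 := by nlinarith
    have q4 : n * x 0 + n * x 1 ≤ 4 * (n : ℝ) := by nlinarith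
    have r1 : -(n : ℤ) < j + 1 := by
      have : (-(n : ℝ)) < j + 1 := by linarith
      exact_mod_cast this
    have r2 : j ≤ (n : ℤ) := by
      have : (j : ℝ) ≤ n := by linarith
      exact_mod_cast this
    have r3 : -(4 * (n : ℤ)) < i + j + 2 := by
      have : -(4 * (n : ℝ)) < i + j + 2 := by linarith
      exact_mod_cast this
    have r4 : i + j ≤ 4 * (n : ℤ) := by
      have : (i : ℝ) + j ≤ 4 * n := by linarith
      exact_mod_cast this
    omega
  · rintro ⟨⟨r1, r2⟩, r3, r4⟩
    have r5 : -4 * (n : ℤ) ≤ i + j ∧ i + j + 2 ≤ 4 * (n : ℤ) := by omega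
    have s1 : (-(n : ℝ)) ≤ j := by exact_mod_cast r1.le
    have s2 : (j : ℝ) + 1 ≤ n := by exact_mod_cast r2
    have s3 : (-4 * (n : ℝ)) ≤ i + j := by exact_mod_cast r5.1
    have s4 : (i : ℝ) + j + 2 ≤ 4 * n := by exact_mod_cast r5.2
    refine ⟨⟨?_, ?_⟩, ?_, ?_⟩ <;> refine le_of_mul_le_mul_left ?_ hpos <;> linarith

/-! ### Pointwise bounds for the distance from the wells -/

/-- The lower triangle of a square is seen by the stencil at `(i, j)`, the upper one by that at
`(i+1, j+1)`. If the latter is in the other phase, a jump occurs on the path through `(i+1, j)`, so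
the corner energy is at least `δ` and absorbs the constant in the crude bound. The boundary
parameters `a₀`, `b₀` are separate from `a`, `b` so that the wells can be interchanged. -/
theorem exists_distWell_grad_sq_le {a b cbar : ℝ} (ha : 0 < a) (hb : 0 < b) (hne : a ≠ b)
    (hc : 0 ≤ cbar) {g : ℝ → ℝ} (hg : IsCutoff cbar g) {k : Quad → ℝ}
    (hk : HasQuadraticGrowth k) (a₀ b₀ lam : ℝ) :
    ∃ K : ℝ, 0 ≤ K ∧ ∀ n : ℕ, 1 ≤ n → ∀ u : Plane → Plane, IsAdmissible a₀ b₀ lam n u →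
      IsPiecewiseAffine n u → ∀ᵐ x, x ∈ Omega →
        distWell (grad u x) (U a b) ^ 2 ≤
          K * (1 + cornerEnergy (density a b g k) n u (cell n x)) ∧
        (cell n x ∉ strip n →
          bracket a b (stencil n u (cell n x)) ≤ bracket b a (stencil n u (cell n x)) →
          distWell (grad u x) (U a b) ^ 2 ≤
            K * cornerEnergy (density a b g k) n u (cell n x)) := by
  have hh := density_nonneg (a := a) (b := b) hg hk
  obtain ⟨K₁, hK₁, hdiff⟩ := exists_norm_sq_diff_le hh (exists_norm_sq_le_density a b hg hk)
    a₀ b₀ lam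
  obtain ⟨K₂, hK₂, hwell⟩ := exists_distWell_sq_le_density ha hb hne hc hg hk
  obtain ⟨δ, hδ, hjump⟩ := exists_le_density_of_jump ha hb hne hc hg hk
  set K₃ := 2 * K₁ + 2 * (a ^ 2 + b ^ 2)
  have hK₃ : 0 ≤ K₃ := by positivity
  refine ⟨K₃ + K₂ + K₃ / δ, by positivity, fun n hn u hu haff => ?_⟩
  filter_upwards [ae_generic n hn] with x hgen hx
  obtain ⟨i, hi⟩ : ∃ i, ⌊n * x 0⌋ = i := ⟨_, rfl⟩
  obtain ⟨j, hj⟩ : ∃ j, ⌊n * x 1⌋ = j := ⟨_, rfl⟩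
  have hcell : cell n x = (i, j) := by rw [cell, hi, hj]
  rw [hcell]
  set N := cornerEnergy (density a b g k) n u (i, j) with hN
  have hN0 : 0 ≤ N := cornerEnergy_nonneg hh _
  obtain ⟨c1, c2, c3, c4⟩ := localEnergy_le_cornerEnergy (n := n) (u := u) hh i j
  rw [← hN] at c1 c2 c3 c4
  have hK₃δ : 0 ≤ K₃ / δ := by positivity
  have hbound : ∀ v w : Plane, ‖v‖ ^ 2 + ‖w‖ ^ 2 ≤ K₁ * (1 + N) →
      distWell (columns v w) (U a b) ^ 2 ≤ K₃ * (1 + N) := by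
    intro v w hvw
    have h1 := distWell_columns_sq_le a b v w
    have h2 : 0 ≤ 2 * (a ^ 2 + b ^ 2) * N := by positivity
    have h3 : K₃ * (1 + N) = 2 * (K₁ * (1 + N)) + 2 * (a ^ 2 + b ^ 2)
      + 2 * (a ^ 2 + b ^ 2) * N := by simp only [K₃]; ring
    linarith
  have hmono : K₃ * (1 + N) ≤ (K₃ + K₂ + K₃ / δ) * (1 + N) :=
    mul_le_mul_of_nonneg_right (by linarith) (by linarith)
  have hmono₂ : K₂ * N ≤ (K₃ + K₂ + K₃ / δ) * N :=
    mul_le_mul_of_nonneg_right (by linarith) hN0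
  rcases grad_cases hn haff hx hi hj hgen with ⟨hgrad, h1, h2, h3, h4⟩ | ⟨hgrad, h1, h2, h3, h4⟩
  · have hb1 := hbound _ _ ((hdiff n hn u hu i j h1 h2).1 h3 h4)
    rw [hgrad]
    refine ⟨hb1.trans hmono, fun hstrip hph => ?_⟩
    rw [mem_strip_iff] at hstrip
    have hq : (i, j) ∈ bulkIndex n := by
      rw [mem_bulkIndex_iff hn, abs_lt, abs_le]; omega
    have hdet := det2_diff_pos_of_triPlus hn hu (triPlus_subset_Omega hn h1 h2 h3 h4)
    have h5 := (hwell _ hph).1 hdet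
    rw [← localEnergy_of_mem (h := density a b g k) hq] at h5
    exact (h5.trans (mul_le_mul_of_nonneg_left c1 hK₂)).trans hmono₂
  · have hb1 := hbound _ _ ((hdiff n hn u hu i j h1 h2).2 h3 h4)
    rw [hgrad]
    refine ⟨hb1.trans hmono, fun hstrip hph => ?_⟩
    rw [mem_strip_iff] at hstrip
    have hp : (i, j) ∈ bulkIndex n := by
      rw [mem_bulkIndex_iff hn, abs_lt, abs_le]; omega
    have hr : (i + 1, j) ∈ bulkIndex n := by
      rw [mem_bulkIndex_iff hn, abs_lt, abs_le]; omega
    have hq : (i + 1, j + 1) ∈ bulkIndex n := by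
      rw [mem_bulkIndex_iff hn, abs_lt, abs_le]; omega
    have hdet := det2_diff_pos_of_triMinus hn hu
      (triMinus_subset_Omega hn (by omega) (by omega) (by omega) (by omega) :
        triMinus n (i + 1) (j + 1) ⊆ Omega)
    rw [localEnergy_of_mem hp] at c1
    rw [localEnergy_of_mem hr] at c2
    rw [localEnergy_of_mem hq] at c4
    have hlarge : δ ≤ N → distWell (columns (TwoWell.hdiff n u i (j + 1))
        (vdiff n u (i + 1) j)) (U a b) ^ 2 ≤ (K₃ + K₂ + K₃ / δ) * N := by
      intro hδN
      have h5 : K₃ ≤ K₃ / δ * N := by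
        rw [div_mul_eq_mul_div, le_div_iff₀ hδ]
        exact mul_le_mul_of_nonneg_left hδN hK₃
      have h6 : 0 ≤ K₂ * N := by positivity
      calc _ ≤ K₃ * (1 + N) := hb1
        _ = K₃ + K₃ * N := by ring
        _ ≤ K₃ / δ * N + K₃ * N + K₂ * N := by linarith
        _ = _ := by ring
    rcases le_total (bracket a b (stencil n u (i + 1, j + 1)))
      (bracket b a (stencil n u (i + 1, j + 1))) with hphq | hphq
    · have h5 := (hwell _ hphq).2 (by rwa [stencil_one, stencil_three])
      rw [stencil_one, stencil_three] at h5
      exact (h5.trans (mul_le_mul_of_nonneg_left c4 hK₂)).trans hmono₂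
    · apply hlarge
      rcases le_total (bracket a b (stencil n u (i + 1, j)))
        (bracket b a (stencil n u (i + 1, j))) with hphr | hphr
      · rcases hjump _ _ hphr hphq
          (Or.inr (Or.inr (Or.inl (by rw [stencil_two, stencil_three])))) with h5 | h5
        · exact h5.trans c2
        · exact h5.trans c4
      · rcases hjump _ _ hph hphr (Or.inl (by rw [stencil_zero, stencil_one])) with h5 | h5
        · exact h5.trans c1
        · exact h5.trans c2

/-! ### Interfaces between the phases -/

/-- The grid points at which the stencil is closer to the well of `diag(a, b)`. -/
def phaseSet (a b : ℝ) (n : ℕ) (u : Plane → Plane) : Set (ℤ × ℤ) :=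
  {p | p ∈ bulkIndex n ∧ bracket a b (stencil n u p) ≤ bracket b a (stencil n u p)}

theorem exists_sum_localEnergy_le {a b lam C : ℝ} {h hhat : Quad → ℝ}
    (hlow : DominatesDensity a b lam h hhat) :
    ∃ C' : ℝ, 0 ≤ C' ∧ ∀ (n : ℕ) (hn : 1 ≤ n) (u : Plane → Plane), IsAdmissible a b lam n u →
      IsPiecewiseAffine n u → energy hhat n u ≤ C / n →
        ∑ p ∈ (bulkIndex_finite hn).toFinset, localEnergy h n u p ≤ C' * n := by
  obtain ⟨c, hc, hlow⟩ := hlow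
  -- The absolute value keeps the new constant nonnegative for any sign of `C`.
  refine ⟨|C| / c, by positivity, fun n hn u hu haff hen => ?_⟩
  have hpos : (0 : ℝ) < n := by exact_mod_cast hn
  rw [energy, finsum_mem_eq_finite_toFinset_sum _ (bulkIndex_finite hn), ← Finset.mul_sum] at hen
  have h1 : c * ∑ p ∈ (bulkIndex_finite hn).toFinset, localEnergy h n u p ≤
      ∑ p ∈ (bulkIndex_finite hn).toFinset, hhat (stencil n u p) := by
    rw [Finset.mul_sum]
    apply Finset.sum_le_sum
    intro p hp
    have hp' : p ∈ bulkIndex n := by simpa using hp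
    rw [localEnergy_of_mem hp']
    exact hlow n hn u hu haff p hp'
  have h2 : ∑ p ∈ (bulkIndex_finite hn).toFinset, hhat (stencil n u p) ≤ C * n := by
    rw [inv_mul_le_iff₀ (by positivity)] at hen
    calc _ ≤ (n : ℝ) ^ 2 * (C / n) := hen
      _ = C * n := by field_simp
  rw [div_mul_eq_mul_div, le_div_iff₀ hc, mul_comm]
  exact h1.trans (h2.trans (mul_le_mul_of_nonneg_right (le_abs_self C) hpos.le))

/-- The interfaces of a set of grid points that are interfaces between the two phases, or between
the domain and its complement, have bounded length. -/
theorem exists_hasTranslationBound {a b cbar : ℝ} (ha : 0 < a) (hb : 0 < b) (hne : a ≠ b)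
    (hc : 0 ≤ cbar) {g : ℝ → ℝ} (hg : IsCutoff cbar g) {k : Quad → ℝ}
    (hk : HasQuadraticGrowth k) {C' : ℝ} (hC' : 0 ≤ C') :
    ∃ C : ℝ, 0 ≤ C ∧ ∀ (n : ℕ) (hn : 1 ≤ n) (u : Plane → Plane),
      ∑ p ∈ (bulkIndex_finite hn).toFinset, localEnergy (density a b g k) n u p ≤ C' * n →
      ∀ P : Set (ℤ × ℤ), P ⊆ bulkIndex n → (∀ p ∈ bulkIndex n, ∀ q ∈ bulkIndex n,
        ¬(p ∈ P ↔ q ∈ P) → ¬(p ∈ phaseSet a b n u ↔ q ∈ phaseSet a b n u)) →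
      HasTranslationBound C (gridSet n P) := by
  have hh := density_nonneg (a := a) (b := b) hg hk
  obtain ⟨δ, hδ, hjump⟩ := exists_le_density_of_jump ha hb hne hc hg hk
  refine ⟨3 * (82 + C' / δ), by positivity, fun n hn u hsum P hP hphase => ?_⟩
  have hpos : (0 : ℝ) < n := by exact_mod_cast hn
  set η := localEnergy (density a b g k) n u with hη
  have hη0 : ∀ p, 0 ≤ η p := localEnergy_nonneg hh
  -- By Chebyshev's inequality at most `C' n / δ` points have energy at least `δ`.
  set large := (bulkIndex_finite hn).toFinset.filter fun p => δ ≤ η p with hlarge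
  have hcl : (large.card : ℝ) ≤ C' / δ * n := by
    have h1 : (large.card : ℝ) * δ ≤ C' * n := by
      calc (large.card : ℝ) * δ = ∑ p ∈ large, δ := by simp
        _ ≤ ∑ p ∈ large, η p := Finset.sum_le_sum fun p hp => (Finset.mem_filter.mp hp).2
        _ ≤ ∑ p ∈ (bulkIndex_finite hn).toFinset, η p :=
          Finset.sum_le_sum_of_subset_of_nonneg (Finset.filter_subset _ _) fun p _ _ => hη0 p
        _ ≤ _ := hsum
    rw [div_mul_eq_mul_div, le_div_iff₀ hδ]
    exact h1
  set bad := strip n ∪ large with hbad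
  have hcb : (bad.card : ℝ) ≤ (82 + C' / δ) * n := by
    have h1 : (bad.card : ℝ) ≤ (strip n).card + large.card := by
      exact_mod_cast Finset.card_union_le _ _
    linarith [card_strip_le hn]
  -- An interface of `P` between neighbours in the index set is a phase jump, so one of them is in
  -- `large`; an interface with the exterior lies in the strip.
  have hmem : ∀ p q : ℤ × ℤ, (p ∈ bulkIndex n → q ∉ bulkIndex n → p ∈ strip n) →
      (q ∈ bulkIndex n → p ∉ bulkIndex n → q ∈ strip n) →
      (‖stencil n u p 0‖ = ‖stencil n u q 1‖ ∨ ‖stencil n u p 2‖ = ‖stencil n u q 3‖) →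
      ¬(p ∈ P ↔ q ∈ P) → p ∈ bad ∨ q ∈ bad := by
    intro p q hpq hqp hbond hne
    by_cases hp : p ∈ bulkIndex n <;> by_cases hq : q ∈ bulkIndex n
    · have hne' := hphase p hp q hq hne
      have h1 : δ ≤ η p ∨ δ ≤ η q := by
        rw [hη, localEnergy_of_mem hp, localEnergy_of_mem hq]
        by_cases hp' : p ∈ phaseSet a b n u
        · have hq' : q ∉ phaseSet a b n u := fun h => hne' (iff_of_true hp' h)
          have hq'' : bracket b a (stencil n u q) ≤ bracket a b (stencil n u q) :=
            (not_le.mp fun h => hq' ⟨hq, h⟩).le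
          refine hjump _ _ hp'.2 hq'' ?_
          rcases hbond with h | h
          · exact Or.inl h
          · exact Or.inr (Or.inr (Or.inl h))
        · have hq' : q ∈ phaseSet a b n u := by
            by_contra h; exact hne' (iff_of_false hp' h)
          have hp'' : bracket b a (stencil n u p) ≤ bracket a b (stencil n u p) :=
            (not_le.mp fun h => hp' ⟨hp, h⟩).le
          refine (hjump _ _ hq'.2 hp'' ?_).symm
          rcases hbond with h | h
          · exact Or.inr (Or.inl h.symm)
          · exact Or.inr (Or.inr (Or.inr h.symm))
      rcases h1 with h1 | h1
      · exact Or.inl (Finset.mem_union_right _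
          (Finset.mem_filter.mpr ⟨(bulkIndex_finite hn).mem_toFinset.mpr hp, h1⟩))
      · exact Or.inr (Finset.mem_union_right _
          (Finset.mem_filter.mpr ⟨(bulkIndex_finite hn).mem_toFinset.mpr hq, h1⟩))
    · exact Or.inl (Finset.mem_union_left _ (hpq hp hq))
    · exact Or.inr (Finset.mem_union_left _ (hqp hq hp))
    · exact absurd (iff_of_false (fun h => hp (hP h)) (fun h => hq (hP h))) hne
  -- Interfaces are indexed by their left or lower point, but the bad point may be the right or
  -- upper one; hence the two shifts and the factor 3.
  set S := bad ∪ (bad.image (fun p => p - (1, 0)) ∪ bad.image fun p => p - (0, 1)) with hS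
  have hcS : (S.card : ℝ) ≤ 3 * bad.card := by
    have h1 : S.card ≤ bad.card + (bad.card + bad.card) :=
      (Finset.card_union_le _ _).trans (add_le_add le_rfl
        ((Finset.card_union_le _ _).trans (add_le_add Finset.card_image_le Finset.card_image_le)))
    have h2 : S.card ≤ 3 * bad.card := by omega
    exact_mod_cast h2
  have hgrid := hasTranslationBound_gridSet hn (P := P) S ?_ ?_
  · refine hgrid.mono ?_
    rw [div_le_iff₀ hpos]
    linarith
  · intro i j hij
    have hout : ((i, j) ∈ bulkIndex n → (i + 1, j) ∉ bulkIndex n → (i, j) ∈ strip n) ∧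
        ((i + 1, j) ∈ bulkIndex n → (i, j) ∉ bulkIndex n → (i + 1, j) ∈ strip n) := by
      rw [mem_bulkIndex_iff hn, mem_bulkIndex_iff hn, mem_strip_iff, mem_strip_iff, abs_lt,
        abs_le, abs_le]
      omega
    rcases hmem (i, j) (i + 1, j) hout.1 hout.2 (Or.inl (by rw [stencil_zero, stencil_one])) hij
      with h | h
    · exact Finset.mem_union_left _ h
    · exact Finset.mem_union_right _ (Finset.mem_union_left _
        (Finset.mem_image.mpr ⟨_, h, by simp⟩))
  · intro i j hij
    have hout : ((i, j) ∈ bulkIndex n → (i, j + 1) ∉ bulkIndex n → (i, j) ∈ strip n) ∧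
        ((i, j + 1) ∈ bulkIndex n → (i, j) ∉ bulkIndex n → (i, j + 1) ∈ strip n) := by
      rw [mem_bulkIndex_iff hn, mem_bulkIndex_iff hn, mem_strip_iff, mem_strip_iff, abs_lt,
        abs_le, abs_lt, abs_le]
      omega
    rcases hmem (i, j) (i, j + 1) hout.1 hout.2 (Or.inr (by rw [stencil_two, stencil_three])) hij
      with h | h
    · exact Finset.mem_union_left _ h
    · exact Finset.mem_union_right _ (Finset.mem_union_right _
        (Finset.mem_image.mpr ⟨_, h, by simp⟩))

/-- Indices in `bulkIndex n` have modulus at most `5n`, and a square adds at most `1/n ≤ 1`. -/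
theorem abs_coord_le_of_mem_gridSet {n : ℕ} (hn : 1 ≤ n) {P : Set (ℤ × ℤ)}
    (hP : P ⊆ bulkIndex n) {x : Plane} (hx : x ∈ gridSet n P) (l : Fin 2) : |x l| ≤ 6 := by
  have hpos : (0 : ℝ) < n := by exact_mod_cast hn
  have hn1 : (1 : ℝ) ≤ n := by exact_mod_cast hn
  obtain ⟨i, hi⟩ : ∃ i, ⌊n * x 0⌋ = i := ⟨_, rfl⟩
  obtain ⟨j, hj⟩ : ∃ j, ⌊n * x 1⌋ = j := ⟨_, rfl⟩
  have hcell : cell n x = (i, j) := by rw [cell, hi, hj]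
  have hmem : (i, j) ∈ bulkIndex n := hP (hcell ▸ hx)
  rw [mem_bulkIndex_iff hn, abs_lt, abs_le] at hmem
  rw [Int.floor_eq_iff] at hi hj
  have s1 : (-(5 * n : ℝ)) ≤ i := by exact_mod_cast (by omega : -(5 * n : ℤ) ≤ i)
  have s2 : (i : ℝ) ≤ 5 * n := by exact_mod_cast (by omega : i ≤ 5 * n)
  have s3 : (-(5 * n : ℝ)) ≤ j := by exact_mod_cast (by omega : -(5 * n : ℤ) ≤ j)
  have s4 : (j : ℝ) ≤ 5 * n := by exact_mod_cast (by omega : j ≤ 5 * n)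
  rw [abs_le]
  fin_cases l
  · constructor <;> refine le_of_mul_le_mul_left ?_ hpos <;> simp only [Fin.zero_eta] <;> linarith
  · constructor <;> refine le_of_mul_le_mul_left ?_ hpos <;> simp only [Fin.mk_one] <;> linarith

theorem volume_Omega_lt_top : volume Omega < ⊤ := by
  have h : volume {x : Plane | x 0 ∈ Set.Icc (-5) 5 ∧ x 1 ∈ Set.Icc (-1) 1} < ⊤ := by
    rw [volume_coord_mem _ _ measurableSet_Icc measurableSet_Icc, Real.volume_Icc,
      Real.volume_Icc]
    exact ENNReal.mul_lt_top ENNReal.ofReal_lt_top ENNReal.ofReal_lt_top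
  refine (measure_mono fun x hx => ?_).trans_lt h
  obtain ⟨h1, h2⟩ := mem_Omega_iff.mp hx
  rw [abs_le] at h1 h2
  exact ⟨⟨by linarith, by linarith⟩, h1⟩

theorem measurableSet_Omega : MeasurableSet Omega := by
  have h : Omega = {x : Plane | |x 1| ≤ 1 ∧ |x 0 + x 1| ≤ 4} := by
    ext x; exact mem_Omega_iff
  rw [h]
  exact (measurableSet_le (measurable_coord 1).abs measurable_const).inter
    (measurableSet_le ((measurable_coord 0).add (measurable_coord 1)).abs measurable_const)

/-! ### Convergence in `L²` -/

theorem measurable_distWell_grad (u : Plane → Plane) (M : Matrix (Fin 2) (Fin 2) ℝ) :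
    Measurable fun x => distWell (grad u x) M := by
  have h1 : Continuous fun L : Plane →L[ℝ] Plane => distWell
      (Matrix.of fun i j => (L (EuclideanSpace.single j 1)) i) M := by
    apply (continuous_distWell M).comp
    apply continuous_matrix
    intro i j
    have : Continuous fun L : Plane →L[ℝ] Plane => L (EuclideanSpace.single j 1) := by fun_prop
    exact (EuclideanSpace.proj (𝕜 := ℝ) i).continuous.comp this
  exact h1.measurable.comp (measurable_fderiv ℝ u)

/-- Every grid point is a corner of exactly four squares. -/
theorem tsum_cornerEnergy {h : Quad → ℝ} (hh : ∀ G, 0 ≤ h G) {n : ℕ} (hn : 1 ≤ n)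
    (u : Plane → Plane) : ∑' p, ENNReal.ofReal (cornerEnergy h n u p) =
      4 * ENNReal.ofReal (∑ p ∈ (bulkIndex_finite hn).toFinset, localEnergy h n u p) := by
  have hη := fun p => localEnergy_nonneg (n := n) (u := u) hh p
  have h1 : ∑' p, ENNReal.ofReal (localEnergy h n u p) =
      ENNReal.ofReal (∑ p ∈ (bulkIndex_finite hn).toFinset, localEnergy h n u p) := by
    rw [ENNReal.ofReal_sum_of_nonneg fun p _ => hη p]
    apply tsum_eq_sum
    intro p hp
    have hp' : p ∉ bulkIndex n := by simpa using hp
    rw [localEnergy, Set.indicator_of_notMem hp', ENNReal.ofReal_zero]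
  have h2 : ∀ q : ℤ × ℤ, ∑' p, ENNReal.ofReal (localEnergy h n u (p + q)) =
      ∑' p, ENNReal.ofReal (localEnergy h n u p) := fun q =>
    (Equiv.addRight q).tsum_eq fun p => ENNReal.ofReal (localEnergy h n u p)
  have h3 : ∀ p, ENNReal.ofReal (cornerEnergy h n u p) =
      ENNReal.ofReal (localEnergy h n u p) + ENNReal.ofReal (localEnergy h n u (p + (1, 0))) +
      ENNReal.ofReal (localEnergy h n u (p + (0, 1))) +
      ENNReal.ofReal (localEnergy h n u (p + (1, 1))) := by
    intro p
    rw [cornerEnergy, ENNReal.ofReal_add (add_nonneg (add_nonneg (hη _) (hη _)) (hη _)) (hη _),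
      ENNReal.ofReal_add (add_nonneg (hη _) (hη _)) (hη _), ENNReal.ofReal_add (hη _) (hη _)]
  simp only [h3]
  rw [ENNReal.tsum_add, ENNReal.tsum_add, ENNReal.tsum_add, h2, h2, h2, h1]
  ring

/-- The integral of the pointwise bound for the squared distance from the well. -/
theorem lintegral_distWell_sq_le {h : Quad → ℝ} (hh : ∀ G, 0 ≤ h G) {n : ℕ} (hn : 1 ≤ n)
    {u : Plane → Plane} {M : Matrix (Fin 2) (Fin 2) ℝ} {K C' : ℝ} (hK : 0 ≤ K)
    (hsum : ∑ p ∈ (bulkIndex_finite hn).toFinset, localEnergy h n u p ≤ C' * n)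
    {A Z : Set Plane} (hA : MeasurableSet A) (hZ : MeasurableSet Z)
    (hle : ∀ᵐ x, x ∈ A → distWell (grad u x) M ^ 2 ≤ K * (1 + cornerEnergy h n u (cell n x)) ∧
      (x ∉ Z → distWell (grad u x) M ^ 2 ≤ K * cornerEnergy h n u (cell n x))) :
    ∫⁻ x in A, ‖distWell (grad u x) M‖ₑ ^ (2 : ℝ) ≤
      ENNReal.ofReal (4 * K * C' / n) + ENNReal.ofReal K * volume Z := by
  have hpos : (0 : ℝ) < n := by exact_mod_cast hn
  have hpt : ∀ᵐ x ∂volume.restrict A, ‖distWell (grad u x) M‖ₑ ^ (2 : ℝ) ≤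
      ENNReal.ofReal K * ENNReal.ofReal (cornerEnergy h n u (cell n x)) +
        ENNReal.ofReal K * Z.indicator 1 x := by
    rw [ae_restrict_iff' hA]
    filter_upwards [hle] with x hx hxA
    obtain ⟨h1, h2⟩ := hx hxA
    have hN := cornerEnergy_nonneg (n := n) (u := u) hh (cell n x)
    rw [Real.enorm_eq_ofReal (distWell_nonneg _ _),
      ENNReal.ofReal_rpow_of_nonneg (distWell_nonneg _ _) (by norm_num), ← ENNReal.ofReal_mul hK]
    simp only [Real.rpow_ofNat]
    by_cases hxZ : x ∈ Z
    · rw [Set.indicator_of_mem hxZ, Pi.one_apply, mul_one,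
        ← ENNReal.ofReal_add (by positivity) hK]
      apply ENNReal.ofReal_le_ofReal
      linarith
    · rw [Set.indicator_of_notMem hxZ, mul_zero, add_zero]
      exact ENNReal.ofReal_le_ofReal (h2 hxZ)
  refine (lintegral_mono_ae hpt).trans ((setLIntegral_le_lintegral _ _).trans ?_)
  have hm1 : Measurable fun x => ENNReal.ofReal (cornerEnergy h n u (cell n x)) :=
    (measurable_of_countable fun p => ENNReal.ofReal (cornerEnergy h n u p)).comp
      (measurable_cell n)
  have hm2 : Measurable (Z.indicator (1 : Plane → ℝ≥0∞)) := measurable_one.indicator hZ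
  rw [lintegral_add_left (hm1.const_mul _), lintegral_const_mul _ hm1, lintegral_const_mul _ hm2,
    lintegral_indicator_one hZ, lintegral_cell hn fun p => ENNReal.ofReal (cornerEnergy h n u p),
    tsum_cornerEnergy hh hn]
  gcongr
  -- Area `n⁻²` per square against a total energy `C' n` counted four times.
  have h4 : ENNReal.ofReal (4 * K * C' / n) = ENNReal.ofReal K *
      (ENNReal.ofReal (1 / (n : ℝ) ^ 2) * (4 * ENNReal.ofReal (C' * n))) := by
    have h5 : (4 : ℝ≥0∞) = ENNReal.ofReal 4 := by simp
    rw [h5, ← ENNReal.ofReal_mul (by norm_num), ← ENNReal.ofReal_mul (by positivity),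
      ← ENNReal.ofReal_mul hK]
    congr 1
    field_simp
  rw [h4]
  gcongr

theorem tendstoZeroL2_of_lintegral_le {f : ℕ → Plane → ℝ} {A : Set Plane}
    (hf : ∀ j, Measurable (f j)) {e : ℕ → ℝ≥0∞} (he : ∀ j, e j < ⊤)
    (hlim : Tendsto e atTop (𝓝 0)) (hle : ∀ j, ∫⁻ x in A, ‖f j x‖ₑ ^ (2 : ℝ) ≤ e j) :
    TendstoZeroL2 f A := by
  have heq : ∀ j, eLpNorm (f j) 2 (volume.restrict A) =
      (∫⁻ x in A, ‖f j x‖ₑ ^ (2 : ℝ)) ^ (1 / 2 : ℝ) := by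
    intro j
    rw [eLpNorm_eq_lintegral_rpow_enorm_toReal (by norm_num) (by norm_num)]
    simp
  have hbd : ∀ j, eLpNorm (f j) 2 (volume.restrict A) ≤ e j ^ (1 / 2 : ℝ) := fun j => by
    rw [heq]
    exact ENNReal.rpow_le_rpow (hle j) (by norm_num)
  refine ⟨fun j => ⟨(hf j).aestronglyMeasurable,
    (hbd j).trans_lt (ENNReal.rpow_lt_top_of_nonneg (by norm_num) (he j).ne)⟩, ?_⟩
  refine tendsto_of_tendsto_of_tendsto_of_le_of_le tendsto_const_nhds ?_ (fun j => zero_le) hbd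
  have := (ENNReal.continuous_rpow_const (y := (1 / 2 : ℝ))).continuousAt.tendsto.comp hlim
  simpa [Function.comp_def] using this

theorem tendsto_const_div_subseq (c : ℝ) {φ : ℕ → ℕ} (hφ : StrictMono φ) :
    Tendsto (fun j => ENNReal.ofReal (c / (φ j : ℝ))) atTop (𝓝 0) := by
  have h1 : Tendsto (fun j => c / ((φ j : ℕ) : ℝ)) atTop (𝓝 0) :=
    (tendsto_const_div_atTop_nhds_zero_nat c).comp hφ.tendsto_atTop
  simpa using ENNReal.tendsto_ofReal h1

theorem volume_gridSet_strip_le {n : ℕ} (hn : 1 ≤ n) :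
    volume (gridSet n (strip n)) ≤ ENNReal.ofReal (82 / n) := by
  have hpos : (0 : ℝ) < n := by exact_mod_cast hn
  refine (volume_gridSet_le hn (strip n) le_rfl).trans (ENNReal.ofReal_le_ofReal ?_)
  rw [div_le_div_iff₀ (by positivity) hpos]
  nlinarith [card_strip_le hn]

/-- A set that differs from unions of grid squares by a null sequence of sets inherits their
translation bound. -/
theorem isCaccioppoli_of_symmDiff_subset {C : ℝ} (hC : 0 ≤ C) {S Z : ℕ → Set Plane}
    {A : Set Plane} (hA : MeasurableSet A) (hAO : A ⊆ Omega)
    (htr : ∀ j, HasTranslationBound C (S j))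
    (hZ : Tendsto (fun j => volume (Z j)) atTop (𝓝 0)) (hsub : ∀ j, S j ∆ A ⊆ Z j) :
    IsCaccioppoli A :=
  isCaccioppoli_of_hasTranslationBound hA ((measure_mono hAO).trans_lt volume_Omega_lt_top) hC
    (HasTranslationBound.of_tendsto htr
      (tendsto_of_tendsto_of_tendsto_of_le_of_le tendsto_const_nhds hZ (fun _ => zero_le)
        fun j => measure_mono (hsub j)))

end

end TwoWell

/-! ### The limit partition and the convergence on its two parts -/

theorem lemma2p1 (a b lam : ℝ) (ha : 0 < a) (hb : 0 < b) (hne : a ≠ b) (hab : a * b = 1)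
    (hlam : lam ∈ Set.Ioo (0 : ℝ) 1)
    (g : ℝ → ℝ) (hg : TwoWell.IsCutoff (TwoWell.wellDist a b) g)
    (k : TwoWell.Quad → ℝ) (hk : TwoWell.HasQuadraticGrowth k)
    (hhat : TwoWell.Quad → ℝ)
    (hhat_lower : TwoWell.DominatesDensity a b lam (TwoWell.density a b g k) hhat)
    (u : ℕ → TwoWell.Plane → TwoWell.Plane)
    (hadm : ∀ n : ℕ, 1 ≤ n → TwoWell.IsAdmissible a b lam n (u n))
    (haff : ∀ n : ℕ, 1 ≤ n → TwoWell.IsPiecewiseAffine n (u n))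
    (C : ℝ) (hscal : ∀ n : ℕ, 1 ≤ n → TwoWell.energy hhat n (u n) ≤ C / n) :
    ∃ φ : ℕ → ℕ, StrictMono φ ∧ (∀ j, 1 ≤ φ j) ∧
      ∃ Ω₀ Ω₁ : Set TwoWell.Plane,
        TwoWell.IsCaccioppoli Ω₀ ∧ TwoWell.IsCaccioppoli Ω₁ ∧
        Disjoint Ω₀ Ω₁ ∧ Ω₀ ∪ Ω₁ = TwoWell.Omega ∧
        TwoWell.TendstoZeroL2
          (fun j x => TwoWell.distWell (TwoWell.grad (u (φ j)) x) (TwoWell.U a b)) Ω₀ ∧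
        TwoWell.TendstoZeroL2
          (fun j x => TwoWell.distWell (TwoWell.grad (u (φ j)) x) (TwoWell.U b a)) Ω₁ := by
  open TwoWell symmDiff in
  have hc := wellDist_nonneg a b
  have hh := density_nonneg (a := a) (b := b) hg hk
  obtain ⟨C', hC', hsum⟩ := exists_sum_localEnergy_le (C := C) hhat_lower
  have hsum' := fun n (hn : 1 ≤ n) => hsum n hn (u n) (hadm n hn) (haff n hn) (hscal n hn)
  obtain ⟨B, hB, htr⟩ := exists_hasTranslationBound ha hb hne hc hg hk hC'
  obtain ⟨K₀, hK₀, hgrad₀⟩ := exists_distWell_grad_sq_le ha hb hne hc hg hk a b lam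
  obtain ⟨K₁, hK₁, hgrad₁⟩ := exists_distWell_grad_sq_le hb ha hne.symm hc hg hk a b lam
  rw [density_comm b a] at hgrad₁
  set P : ℕ → Set (ℤ × ℤ) := fun n => phaseSet a b n (u n)
  have hP : ∀ n, P n ⊆ bulkIndex n := fun n p hp => hp.1
  have htr₀ : ∀ n, 1 ≤ n → HasTranslationBound B (gridSet n (P n)) := fun n hn =>
    htr n hn (u n) (hsum' n hn) _ (hP n) fun p _ q _ h => h
  -- Inside the index set the complementary phase has the same interfaces, so the same bound
  -- applies.
  have htr₁ : ∀ n, 1 ≤ n → HasTranslationBound B (gridSet n (bulkIndex n \ P n)) := fun n hn =>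
    htr n hn (u n) (hsum' n hn) _ Set.sdiff_subset fun p hp q hq h h' => h (by
      simp only [Set.mem_sdiff, hp, hq, true_and]
      exact not_congr h')
  -- The shift to `m + 1` avoids the degenerate grid `n = 0`.
  obtain ⟨E, hE, hEfin, ψ, hψ, hlim⟩ := exists_subseq_tendsto_measure (M := 6) hB
    (S := fun m => gridSet (m + 1) (P (m + 1))) (fun m => measurableSet_gridSet _ _)
    (fun m x hx l => abs_coord_le_of_mem_gridSet (by omega) (hP _) hx l)
    (fun m => htr₀ _ (by omega))
  set φ : ℕ → ℕ := fun j => ψ j + 1 with hφdef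
  have hφ : StrictMono φ := fun i j hij => Nat.succ_lt_succ (hψ hij)
  have hφ1 : ∀ j, 1 ≤ φ j := fun j => Nat.le_add_left 1 _
  set D : ℕ → Set Plane := fun j => gridSet (φ j) (P (φ j)) ∆ E with hD
  have hDm : ∀ j, MeasurableSet (D j) := fun j => (measurableSet_gridSet _ _).symmDiff hE
  have hOm := measurableSet_Omega
  set Z : ℕ → Set Plane := fun j => gridSet (φ j) (strip (φ j)) ∪ D j with hZ
  have hZm : ∀ j, MeasurableSet (Z j) := fun j => (measurableSet_gridSet _ _).union (hDm j)
  have hZlim : Tendsto (fun j => volume (Z j)) atTop (𝓝 0) := by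
    have h1 := (tendsto_const_div_subseq 82 hφ).add hlim
    rw [add_zero] at h1
    exact tendsto_of_tendsto_of_tendsto_of_le_of_le tendsto_const_nhds h1 (fun j => zero_le)
      fun j => (measure_union_le _ _).trans
        (add_le_add (volume_gridSet_strip_le (hφ1 j)) le_rfl)
  -- Off the exceptional set, whose measure tends to zero, the discrete domain and phase agree with
  -- `Omega` and `E`.
  have hbulk : ∀ j x, x ∉ Z j → (x ∈ Omega ↔ cell (φ j) x ∈ bulkIndex (φ j)) ∧
      (cell (φ j) x ∈ P (φ j) ↔ x ∈ E) := by
    intro j x hx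
    rw [hZ, Set.mem_union, not_or] at hx
    refine ⟨mem_Omega_iff_of_notMem_strip (hφ1 j) hx.1, ?_⟩
    by_contra hiff
    apply hx.2
    by_cases hxE : x ∈ E
    · exact Or.inr ⟨hxE, fun h => hiff (iff_of_true h hxE)⟩
    · refine Or.inl ⟨?_, hxE⟩
      by_contra h
      exact hiff (iff_of_false h hxE)
  have herr : ∀ K : ℝ, (∀ j, ENNReal.ofReal (4 * K * C' / φ j) +
        ENNReal.ofReal K * volume (Z j) < ⊤) ∧
      Tendsto (fun j => ENNReal.ofReal (4 * K * C' / φ j) + ENNReal.ofReal K * volume (Z j))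
        atTop (𝓝 0) := by
    intro K
    constructor
    · intro j
      have hstrip := (volume_gridSet_strip_le (hφ1 j)).trans_lt ENNReal.ofReal_lt_top
      exact ENNReal.add_lt_top.mpr ⟨ENNReal.ofReal_lt_top, ENNReal.mul_lt_top
        ENNReal.ofReal_lt_top ((measure_union_le _ _).trans_lt
          (ENNReal.add_lt_top.mpr ⟨hstrip, hEfin (ψ j)⟩))⟩
    · have h1 := (tendsto_const_div_subseq (4 * K * C') hφ).add
        (ENNReal.Tendsto.const_mul (a := ENNReal.ofReal K) hZlim (Or.inr ENNReal.ofReal_ne_top))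
      simpa using h1
  -- `E` comes from an `L¹` limit and may leave `Omega`; cutting with `Omega` makes the partition
  -- exact.
  refine ⟨φ, hφ, hφ1, E ∩ Omega, Omega \ E, ?_, ?_, ?_, ?_, ?_, ?_⟩
  · refine isCaccioppoli_of_symmDiff_subset hB (hE.inter hOm) Set.inter_subset_right
      (fun j => htr₀ (φ j) (hφ1 j)) hZlim fun j x hx => ?_
    by_contra hxZ
    obtain ⟨h1, h2⟩ := hbulk j x hxZ
    rcases hx with ⟨h3, h4⟩ | ⟨h3, h4⟩
    · exact h4 ⟨h2.mp h3, h1.mpr (hP _ h3)⟩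
    · exact h4 (h2.mpr h3.1)
  · refine isCaccioppoli_of_symmDiff_subset hB (hOm.diff hE) Set.sdiff_subset
      (fun j => htr₁ (φ j) (hφ1 j)) hZlim fun j x hx => ?_
    by_contra hxZ
    obtain ⟨h1, h2⟩ := hbulk j x hxZ
    rcases hx with ⟨h3, h4⟩ | ⟨h3, h4⟩
    · exact h4 ⟨h1.mpr h3.1, fun h => h3.2 (h2.mpr h)⟩
    · exact h4 ⟨h1.mp h3.1, fun h => h3.2 (h2.mp h)⟩
  · exact Set.disjoint_left.mpr fun x hx hx' => hx'.2 hx.1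
  · rw [Set.inter_comm]
    exact Set.inter_union_sdiff _ _
  · refine tendstoZeroL2_of_lintegral_le (fun j => measurable_distWell_grad _ _)
      (herr K₀).1 (herr K₀).2 fun j => ?_
    refine lintegral_distWell_sq_le hh (hφ1 j) hK₀ (hsum' _ (hφ1 j)) (hE.inter hOm) (hZm j) ?_
    filter_upwards [hgrad₀ (φ j) (hφ1 j) _ (hadm _ (hφ1 j)) (haff _ (hφ1 j))] with x hx hxA
    refine ⟨(hx hxA.2).1, fun hxZ => (hx hxA.2).2 (fun h => hxZ (Or.inl h)) ?_⟩
    exact ((hbulk j x hxZ).2.mpr hxA.1).2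
  · refine tendstoZeroL2_of_lintegral_le (fun j => measurable_distWell_grad _ _)
      (herr K₁).1 (herr K₁).2 fun j => ?_
    refine lintegral_distWell_sq_le hh (hφ1 j) hK₁ (hsum' _ (hφ1 j)) (hOm.diff hE) (hZm j) ?_
    filter_upwards [hgrad₁ (φ j) (hφ1 j) _ (hadm _ (hφ1 j)) (haff _ (hφ1 j))] with x hx hxA
    refine ⟨(hx hxA.1).1, fun hxZ => (hx hxA.1).2 (fun h => hxZ (Or.inl h)) ?_⟩
    -- Outside `E` and the exceptional set the grid point is in the index set but not in the first
    -- phase, so its bracket for `diag(b, a)` is the smaller one.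
    obtain ⟨h1, h2⟩ := hbulk j x hxZ
    exact (not_le.mp fun h => hxA.2 (h2.mp ⟨h1.mp hxA.1, h⟩)).le
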